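/- Let $r\ge 1$ be an integer and $\rho>0$. There are constants $C,C',K',c>0$, depending only on $r$ and $\rho$, such that the following holds for all $\alpha\in(0,1)$, all integers $m,N$ and $1\le k\le N$ with $\lambda:=m/k\ge (C\log(eN/k))^{1/(1-\alpha)}$, and all $\Delta>0$. Let $\Phi$ be a random $m\times N$ matrix with independent, mean-zero, unit-variance entries that are $\rho$-subgaussian, i.e. $\mathbb P(|\Phi_{ij}|\ge t)\le 2\exp(-t^2/(2\rho^2))$ for all $t\ge 0$. Then with probability at least $1-\exp(-c\,m\lambda^{-\alpha})$ the following holds simultaneously for all $x\in\mathbb R^N$ with at most $k$ nonzero entries and $\min_{j\in\operatorname{supp}x}|x_j|>K'\Delta$: the $r$-th order $\Sigma\Delta$ reconstruction $\hat x$ of $x$ exists and satisfies $$\|x-\hat x\|_2\le C'\lambda^{-\alpha(r-1/2)}\Delta .$$ Here $\hat x$ is any vector obtained as follows (wherever a minimizer is not unique, any choice is allowed). 1. Quantization. Put $y=\Phi x$. With $u_i=0$ for $i\le 0$, choose successively for $i=1,\dots,m$ an element $q_i\in\Delta\mathbb Z$ for which the number $u_i$ determined by $\sum_{j=0}^r\binom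 rj(-1)^ju_{i-j}=y_i-q_i$ has minimal absolute value. 2. Support recovery. Let $x'$ minimize $\|z\|_1$ subject to $\|\Phi z-q\|_2\le 2^{r-1}\Delta\sqrt m$, and let $T$ be a set of $k$ indices at which the entries of $x'$ are largest in absolute value. 3. Sobolev dual. Let $D\in\mathbb R^{m\times m}$ have entries $1$ on the diagonal, $-1$ on the first subdiagonal, and $0$ elsewhere, and let $\Phi_T$ be the submatrix of the columns of $\Phi$ indexed by $T$. Let $L$ minimize the $\ell_2\to\ell_2$ operator norm $\|LD^r\|_{2\to2}$ over all left inverses $L$ of $\Phi_T$. Set $\hat x_T=Lq$ and $\hat x_j=0$ for $j\notin T$. -/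

import Mathlib

namespace SigmaDelta

open MeasureTheory

/-- `X` is `ρ`-subgaussian: `ℙ(|X| ≥ t) ≤ 2 exp (-t² / (2ρ²))` for all `t ≥ 0`. -/
def IsSubgaussian {Ω : Type*} [MeasurableSpace Ω] (μ : Measure Ω) (ρ : ℝ) (X : Ω → ℝ) : Prop :=
  ∀ t : ℝ, 0 ≤ t → μ.real {ω | t ≤ |X ω|} ≤ 2 * Real.exp (-t ^ 2 / (2 * ρ ^ 2))

/-- The Euclidean norm of a finite real vector. -/
noncomputable def l2norm {ι : Type*} [Fintype ι] (v : ι → ℝ) : ℝ :=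
  ‖WithLp.toLp 2 v‖

open scoped Matrix.Norms.L2Operator in
/-- The operator norm of a real matrix with respect to Euclidean norms. -/
noncomputable def l2opNorm {ι κ : Type*} [Fintype ι] [Fintype κ] [DecidableEq κ]
    (A : Matrix ι κ ℝ) : ℝ :=
  ‖A‖

/-- The vector `x` has at most `k` nonzero entries. -/
def IsSparse {N : ℕ} (k : ℕ) (x : Fin N → ℝ) : Prop :=
  (Finset.univ.filter fun j => x j ≠ 0).card ≤ k

/-- The finite difference matrix: `1` on the diagonal, `-1` just below it, `0` elsewhere. -/
def diffMatrix (m : ℕ) : Matrix (Fin m) (Fin m) ℝ :=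
  Matrix.of fun i j => if i = j then 1 else if (i : ℕ) = (j : ℕ) + 1 then -1 else 0

/-- `q` is an output of the greedy `r`th order `ΣΔ` quantizer with alphabet `Δℤ` and input `y`:
for some state sequence `u`, vanishing before the first time step (here time `0`), the `r`th
finite difference of `u` at each time `i` is `y i - q i`, and `q i ∈ Δℤ` minimizes `|u i|`.
(Replacing `q i` by `Δ * n` would replace `u i` by `u i + q i - Δ * n`.)
Ties may be broken in any way. -/
def IsQuantization {m : ℕ} (r : ℕ) (Δ : ℝ) (y q : Fin m → ℝ) : Prop :=
  ∃ u : ℤ → ℝ,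
    (∀ i : ℤ, i < 0 → u i = 0) ∧
    ∀ i : Fin m,
      (∃ n : ℤ, q i = Δ * n) ∧
      (∑ j ∈ Finset.range (r + 1),
          (r.choose j : ℝ) * (-1) ^ j * u (((i : ℕ) : ℤ) - (j : ℤ)) = y i - q i) ∧
      ∀ n : ℤ, |u ((i : ℕ) : ℤ)| ≤ |u ((i : ℕ) : ℤ) + q i - Δ * n|

/-- `z` minimizes `‖z‖₁` subject to `‖Φ z - q‖₂ ≤ ε`. -/
def IsL1Minimizer {m N : ℕ} (Φ : Matrix (Fin m) (Fin N) ℝ) (q : Fin m → ℝ) (ε : ℝ)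
    (z : Fin N → ℝ) : Prop :=
  l2norm (Φ.mulVec z - q) ≤ ε ∧
    ∀ w : Fin N → ℝ, l2norm (Φ.mulVec w - q) ≤ ε → ∑ j, |z j| ≤ ∑ j, |w j|

/-- `T` is an index set of `k` entries of `z` that are largest in absolute value. -/
def IsLargestIndexSet {N : ℕ} (k : ℕ) (z : Fin N → ℝ) (T : Finset (Fin N)) : Prop :=
  T.card = k ∧ ∀ i ∈ T, ∀ j ∉ T, |z j| ≤ |z i|

/-- The submatrix of the columns of `Φ` with index in `T`. -/
def colSubmatrix {m N : ℕ} (Φ : Matrix (Fin m) (Fin N) ℝ) (T : Finset (Fin N)) :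
    Matrix (Fin m) T ℝ :=
  Φ.submatrix id Subtype.val

/-- `L` is an `r`th order Sobolev dual of `A`: it minimizes the operator norm of `L D^r` among
all left inverses of `A`. -/
def IsSobolevDual {m : ℕ} {κ : Type*} [Fintype κ] [DecidableEq κ] (r : ℕ)
    (A : Matrix (Fin m) κ ℝ) (L : Matrix κ (Fin m) ℝ) : Prop :=
  L * A = 1 ∧
    ∀ M : Matrix κ (Fin m) ℝ, M * A = 1 →
      l2opNorm (L * diffMatrix m ^ r) ≤ l2opNorm (M * diffMatrix m ^ r)

/-- `xhat` is reconstructed from the quantized measurements `q`: with a solution `z` of the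
`ℓ¹` minimization problem at noise level `2^(r-1) Δ √m` and the index set `T` of the `k` largest
entries of `z`, one sets `xhat = L q` on `T`, with `L` a Sobolev dual of the columns of `Φ` in `T`,
and `xhat = 0` off `T`. -/
def IsReconstruction {m N : ℕ} (r k : ℕ) (Δ : ℝ) (Φ : Matrix (Fin m) (Fin N) ℝ)
    (q : Fin m → ℝ) (xhat : Fin N → ℝ) : Prop :=
  ∃ z : Fin N → ℝ, IsL1Minimizer Φ q (2 ^ r / 2 * Δ * √(m : ℝ)) z ∧
  ∃ T : Finset (Fin N), IsLargestIndexSet k z T ∧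
  ∃ L : Matrix T (Fin m) ℝ, IsSobolevDual r (colSubmatrix Φ T) L ∧
    (∀ j : T, xhat j = L.mulVec q j) ∧ ∀ j ∉ T, xhat j = 0

end SigmaDelta

/-!
The reconstruction error is `L D^r u`, where `u` is the state of the quantizer, whose entries are at
most `Δ / 2`, and `L` is the Sobolev dual. The minimal norm of `L D^r` is the reciprocal of the
smallest singular value of `D^(-r) Φ_T` (`exists_minimal_left_inverse`). So everything rests on a
lower bound for `‖D^(-r) Φ x‖`, uniform over sparse `x`, and on the support recovery.

For the lower bound no singular value decomposition of `D^(-r)` and no concentration of general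
quadratic forms is needed. With `h ≈ λ^α`, a difference of step `h` has norm at most `2`, and
`(1 - X^h)^r (1 - X)^(-r) = (1 + X + ⋯ + X^(h-1))^r`. Hence `2^r ‖D^(-r) y‖` dominates the norm of the
convolution of `y` with a discrete B-spline, which is supported in a window of width `w = r h` and has
mass `h^r` (`exists_filters`). The entries of this convolution at positions that agree modulo `w`
involve disjoint windows of `y = Φ x`, so they are independent, centred and subgaussian, and the sum
of their squares is bounded below except with exponentially small probability. The dependence between
the `w` residue classes does not matter: by convexity of `exp`, the exponential moment of an average is
at most the largest of the exponential moments (`measureReal_avg_sum_sq`). A union bound over `ε`-nets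
of the spaces of vectors with a given support makes the bound uniform
(`exists_event_filteredEnergy_bounds`).

The same bounds with the trivial filter show that `Φ` itself is well conditioned, up to constants, on
vectors with a constant multiple of `k` nonzero entries. Cutting a vector of the `ℓ¹` cone into
blocks of decreasing magnitude then shows that an `ℓ¹` minimizer is entrywise within a multiple of `Δ` of `x`
(`IsL1Minimizer.abs_sub_le`), so its `k` largest entries cover the support of `x`, and the
deterministic error analysis applies (`reconstruction_of_bounds`).
-/

namespace SigmaDelta

open MeasureTheory ProbabilityTheory

/-! ### Subgaussian random variables -/

section Subgaussian

variable {Ω : Type*} [MeasurableSpace Ω] {μ : Measure Ω} [IsProbabilityMeasure μ]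

/-- A subgaussian tail gives a bounded square-exponential moment, by the layer cake formula. -/
lemma lintegral_exp_sq_le {c : ℝ} (hc : 0 < c) {Y : Ω → ℝ} (hY : Measurable Y)
    (htail : ∀ t : ℝ, 0 ≤ t → μ.real {ω | t ≤ |Y ω|} ≤ 2 * Real.exp (-t ^ 2 / (2 * c))) :
    ∫⁻ ω, ENNReal.ofReal (Real.exp (Y ω ^ 2 / (4 * c))) ∂μ ≤ 3 := by
  rw [lintegral_eq_lintegral_meas_le μ (Filter.Eventually.of_forall fun ω => (Real.exp_pos _).le)
    (by fun_prop)]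
  rw [← Set.Ioc_union_Ioi_eq_Ioi (zero_le_one' ℝ), lintegral_union measurableSet_Ioi
    (Set.Ioc_disjoint_Ioi le_rfl)]
  have h1 : ∫⁻ t in Set.Ioc (0 : ℝ) 1, μ {ω | t ≤ Real.exp (Y ω ^ 2 / (4 * c))} ≤ 1 := by
    calc _ ≤ ∫⁻ t in Set.Ioc (0 : ℝ) 1, 1 := lintegral_mono fun t => prob_le_one
      _ = 1 := by simp
  have h2 : ∫⁻ t in Set.Ioi (1 : ℝ), μ {ω | t ≤ Real.exp (Y ω ^ 2 / (4 * c))} ≤ 2 := by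
    calc _ ≤ ∫⁻ t in Set.Ioi (1 : ℝ), ENNReal.ofReal (2 * t ^ (-2 : ℝ)) := by
          refine setLIntegral_mono' measurableSet_Ioi fun t ht => ?_
          have ht1 : (1 : ℝ) < t := ht
          have ht0 : 0 < t := by linarith
          have hlog : 0 < Real.log t := Real.log_pos ht1
          have hsub : {ω | t ≤ Real.exp (Y ω ^ 2 / (4 * c))}
              ⊆ {ω | √(4 * c * Real.log t) ≤ |Y ω|} := by
            intro ω hω
            simp only [Set.mem_ofPred_eq] at hω ⊢
            refine Real.sqrt_le_iff.2 ⟨abs_nonneg _, ?_⟩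
            rw [sq_abs]
            have := (Real.log_le_iff_le_exp ht0).2 hω
            rw [le_div_iff₀ (by positivity)] at this
            linarith
          have := htail (√(4 * c * Real.log t)) (Real.sqrt_nonneg _)
          rw [Real.sq_sqrt (by positivity)] at this
          have he : -(4 * c * Real.log t) / (2 * c) = Real.log t * (-2) := by
            field_simp; ring
          rw [he, ← Real.rpow_def_of_pos ht0] at this
          refine (measure_mono hsub).trans ?_
          rw [← ofReal_measureReal]
          exact ENNReal.ofReal_le_ofReal this
      _ = ENNReal.ofReal (∫ t in Set.Ioi (1 : ℝ), 2 * t ^ (-2 : ℝ)) := by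
          rw [ofReal_integral_eq_lintegral_ofReal]
          · exact (integrableOn_Ioi_rpow_of_lt (by norm_num) one_pos).const_mul 2
          · refine (ae_restrict_iff' measurableSet_Ioi).2 (Filter.Eventually.of_forall fun t ht => ?_)
            have ht1 : (1 : ℝ) < t := ht
            have ht0 : 0 < t := by linarith
            show 0 ≤ 2 * t ^ (-2 : ℝ)
            positivity
      _ = 2 := by
          rw [integral_const_mul, integral_Ioi_rpow_of_lt (by norm_num) one_pos]
          norm_num
  calc _ ≤ (1 : ENNReal) + 2 := add_le_add h1 h2
    _ = 3 := by norm_num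

omit [IsProbabilityMeasure μ] in
lemma integrable_exp_sq {c : ℝ} {Y : Ω → ℝ} (hY : Measurable Y)
    (h : ∫⁻ ω, ENNReal.ofReal (Real.exp (Y ω ^ 2 / (4 * c))) ∂μ ≤ 3) :
    Integrable (fun ω => Real.exp (Y ω ^ 2 / (4 * c))) μ := by
  refine ⟨by fun_prop, ?_⟩
  rw [hasFiniteIntegral_iff_ofReal (Filter.Eventually.of_forall fun ω => (Real.exp_pos _).le)]
  exact h.trans_lt (by norm_num)

omit [IsProbabilityMeasure μ] in
lemma integral_exp_sq_le {c : ℝ} {Y : Ω → ℝ} (hY : Measurable Y)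
    (h : ∫⁻ ω, ENNReal.ofReal (Real.exp (Y ω ^ 2 / (4 * c))) ∂μ ≤ 3) :
    ∫ ω, Real.exp (Y ω ^ 2 / (4 * c)) ∂μ ≤ 3 := by
  rw [integral_eq_lintegral_of_nonneg_ae
    (Filter.Eventually.of_forall fun ω => (Real.exp_pos _).le) (by fun_prop)]
  exact ENNReal.toReal_le_of_le_ofReal (by norm_num) (by simpa using h)

lemma integral_const_add_mul_add_mul {a b d : ℝ} {F G : Ω → ℝ} (hF : Integrable F μ)
    (hG : Integrable G μ) :
    ∫ ω, (a + b * F ω + d * G ω) ∂μ = a + b * ∫ ω, F ω ∂μ + d * ∫ ω, G ω ∂μ := by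
  have h1 : Integrable (fun ω => a + b * F ω) μ := (integrable_const a).add (hF.const_mul b)
  rw [integral_add h1 (hG.const_mul d), integral_add (integrable_const a) (hF.const_mul b),
    integral_const_mul, integral_const_mul]
  simp

/-- The remainder of `exp` after two terms, on the whole line. -/
lemma exp_le_one_add_add_sq_mul_exp_abs (x : ℝ) :
    Real.exp x ≤ 1 + x + x ^ 2 * Real.exp |x| := by
  have h := Complex.norm_exp_sub_sum_le_norm_mul_exp (x : ℂ) 2
  have e : Complex.exp (x : ℂ) - ∑ m ∈ Finset.range 2, (x : ℂ) ^ m / (m.factorial : ℂ)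
      = ((Real.exp x - (1 + x) : ℝ) : ℂ) := by
    simp [Finset.sum_range_succ]
  rw [e, Complex.norm_real, Complex.norm_real, Real.norm_eq_abs, Real.norm_eq_abs, sq_abs] at h
  linarith [le_abs_self (Real.exp x - (1 + x))]

/-- A centred variable with a bounded square-exponential moment has a subgaussian moment
generating function. The Taylor expansion of `exp` gives `1 + 24 c t² exp (2 c t²)` as a bound,
whence the parameter `52 c = 2 (24 c + 2 c)`. -/
lemma hasSubgaussianMGF_of_lintegral_exp_sq_le {c : NNReal} (hc : 0 < c) {Y : Ω → ℝ}
    (hY : Measurable Y)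
    (h : ∫⁻ ω, ENNReal.ofReal (Real.exp (Y ω ^ 2 / (4 * c))) ∂μ ≤ 3)
    (hmean : ∫ ω, Y ω ∂μ = 0) :
    HasSubgaussianMGF Y (52 * c) μ := by
  have hc' : (0 : ℝ) < c := hc
  have hint := integrable_exp_sq hY h
  have h3 := integral_exp_sq_le hY h
  -- spend half of the available exponential moment on `exp |t y|` and the other half on `y²`
  have key1 : ∀ t y : ℝ, |t * y| ≤ 2 * c * t ^ 2 + y ^ 2 / (8 * c) := by
    intro t y
    have : 2 * c * t ^ 2 + y ^ 2 / (8 * c) - |t * y| = 2 * c * (|t| - |y| / (4 * c)) ^ 2 := by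
      rw [abs_mul, ← sq_abs t, ← sq_abs y]; field_simp; ring
    have h2 : 0 ≤ 2 * c * (|t| - |y| / (4 * c)) ^ 2 := by positivity
    linarith
  have key2 : ∀ t y : ℝ, y ^ 2 * Real.exp |t * y|
      ≤ 8 * c * Real.exp (2 * c * t ^ 2) * Real.exp (y ^ 2 / (4 * c)) := by
    intro t y
    have h1 : y ^ 2 ≤ 8 * c * Real.exp (y ^ 2 / (8 * c)) := by
      have := Real.add_one_le_exp (y ^ 2 / (8 * c))
      calc y ^ 2 = 8 * c * (y ^ 2 / (8 * c)) := by field_simp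
        _ ≤ _ := by gcongr; linarith
    calc y ^ 2 * Real.exp |t * y|
        ≤ (8 * c * Real.exp (y ^ 2 / (8 * c))) * Real.exp (2 * c * t ^ 2 + y ^ 2 / (8 * c)) := by
          gcongr; exact key1 t y
      _ = _ := by
          have : y ^ 2 / (4 * c) = y ^ 2 / (8 * c) + y ^ 2 / (8 * c) := by field_simp; ring
          rw [this, Real.exp_add, Real.exp_add]; ring
  have hYint : Integrable Y μ := by
    refine Integrable.mono' ((hint.const_mul (Real.exp (2 * c)))) hY.aestronglyMeasurable
      (Filter.Eventually.of_forall fun ω => ?_)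
    have h1 := key1 1 (Y ω)
    rw [one_mul] at h1
    rw [Real.norm_eq_abs, ← Real.exp_add]
    have h2 := Real.add_one_le_exp (2 * c + Y ω ^ 2 / (4 * c))
    have h3 : Y ω ^ 2 / (8 * c) ≤ Y ω ^ 2 / (4 * c) := by
      gcongr; norm_num
    linarith
  have hbound : ∀ t : ℝ, ∀ ω, Real.exp (t * Y ω) ≤ 1 + t * Y ω
      + t ^ 2 * (8 * c * Real.exp (2 * c * t ^ 2)) * Real.exp (Y ω ^ 2 / (4 * c)) := by
    intro t ω
    refine (exp_le_one_add_add_sq_mul_exp_abs (t * Y ω)).trans ?_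
    have := mul_le_mul_of_nonneg_left (key2 t (Y ω)) (sq_nonneg t)
    nlinarith
  have hI : ∀ t : ℝ, Integrable (fun ω => 1 + t * Y ω
      + t ^ 2 * (8 * c * Real.exp (2 * c * t ^ 2)) * Real.exp (Y ω ^ 2 / (4 * c))) μ := fun t =>
    ((integrable_const _).add (hYint.const_mul t)).add (hint.const_mul _)
  have hE : ∀ t : ℝ, Integrable (fun ω => Real.exp (t * Y ω)) μ := fun t =>
    (hI t).mono' (by fun_prop) (Filter.Eventually.of_forall fun ω => by
      rw [Real.norm_eq_abs, abs_of_pos (Real.exp_pos _)]; exact hbound t ω)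
  refine ⟨hE, fun t => ?_⟩
  rw [mgf]
  have hle := integral_mono (hE t) (hI t) (hbound t)
  have hval : ∫ ω, (1 + t * Y ω
      + t ^ 2 * (8 * c * Real.exp (2 * c * t ^ 2)) * Real.exp (Y ω ^ 2 / (4 * c))) ∂μ
      = 1 + t ^ 2 * (8 * c * Real.exp (2 * c * t ^ 2)) * ∫ ω, Real.exp (Y ω ^ 2 / (4 * c)) ∂μ := by
    rw [integral_const_add_mul_add_mul hYint hint, hmean, mul_zero, add_zero]
  rw [hval] at hle
  refine hle.trans ?_
  have e1 : (((52 * c : NNReal) : ℝ)) * t ^ 2 / 2 = 24 * c * t ^ 2 + 2 * c * t ^ 2 := by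
    push_cast; ring
  rw [e1, Real.exp_add]
  have h5 : 1 ≤ Real.exp (2 * c * t ^ 2) := Real.one_le_exp (by positivity)
  calc 1 + t ^ 2 * (8 * c * Real.exp (2 * c * t ^ 2)) * ∫ ω, Real.exp (Y ω ^ 2 / (4 * c)) ∂μ
      ≤ 1 * Real.exp (2 * c * t ^ 2) + t ^ 2 * (8 * c * Real.exp (2 * c * t ^ 2)) * 3 := by
        gcongr; linarith
    _ = (24 * c * t ^ 2 + 1) * Real.exp (2 * c * t ^ 2) := by ring
    _ ≤ _ := by gcongr; exact Real.add_one_le_exp _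

lemma lintegral_exp_sq_le_of_hasSubgaussianMGF {c : NNReal} (hc : 0 < c) {Y : Ω → ℝ}
    (hY : Measurable Y) (h : HasSubgaussianMGF Y c μ) :
    ∫⁻ ω, ENNReal.ofReal (Real.exp (Y ω ^ 2 / (4 * c))) ∂μ ≤ 3 := by
  refine lintegral_exp_sq_le (c := c) hc hY fun t ht => ?_
  have h1 := h.measure_ge_le ht
  have h2 := h.neg.measure_ge_le ht
  have hsub : {ω | t ≤ |Y ω|} ⊆ {ω | t ≤ Y ω} ∪ {ω | t ≤ (-Y) ω} := by
    intro ω hω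
    have hω' : t ≤ |Y ω| := hω
    rcases le_abs'.1 hω' with h | h
    · right; simp only [Set.mem_ofPred_eq, Pi.neg_apply]; linarith
    · left; exact h
  calc _ ≤ μ.real ({ω | t ≤ Y ω} ∪ {ω | t ≤ (-Y) ω}) := measureReal_mono hsub
    _ ≤ _ := measureReal_union_le _ _
    _ ≤ _ := by linarith

/-- For a unit-variance subgaussian variable, the Laplace transform of the square is close to
that of the constant `1`. -/
lemma lintegral_exp_neg_sq_le {c : NNReal} (hc : 0 < c) {Y : Ω → ℝ} (hY : Measurable Y)
    (h : HasSubgaussianMGF Y c μ) (hvar : ∫ ω, Y ω ^ 2 ∂μ = 1) {s : ℝ} (hs : 0 ≤ s) :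
    ∫⁻ ω, ENNReal.ofReal (Real.exp (-(s * Y ω ^ 2))) ∂μ
      ≤ ENNReal.ofReal (Real.exp (-s + 96 * c ^ 2 * s ^ 2)) := by
  have hc' : (0 : ℝ) < c := hc
  have hl := lintegral_exp_sq_le_of_hasSubgaussianMGF hc hY h
  have hint := integrable_exp_sq hY hl
  have h3 := integral_exp_sq_le hY hl
  have hYsq : Integrable (fun ω => Y ω ^ 2) μ :=
    (h.memLp 2).integrable_sq
  have hE : Integrable (fun ω => Real.exp (-(s * Y ω ^ 2))) μ := by
    refine (integrable_const (1 : ℝ)).mono' (by fun_prop) (Filter.Eventually.of_forall fun ω => ?_)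
    rw [Real.norm_eq_abs, abs_of_pos (Real.exp_pos _), Real.exp_le_one_iff]
    have : 0 ≤ s * Y ω ^ 2 := by positivity
    linarith
  have hb : ∀ ω, Real.exp (-(s * Y ω ^ 2)) ≤ 1 - s * Y ω ^ 2
      + s ^ 2 * (32 * c ^ 2) * Real.exp (Y ω ^ 2 / (4 * c)) := by
    intro ω
    have hz : 0 ≤ s * Y ω ^ 2 := by positivity
    have h1 : Real.exp (-(s * Y ω ^ 2)) ≤ 1 - s * Y ω ^ 2 + (s * Y ω ^ 2) ^ 2 := by
      -- `exp (-z) ≤ 1 / (1 + z) ≤ 1 - z + z²` for `z ≥ 0`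
      have h5 := Real.add_one_le_exp (s * Y ω ^ 2)
      rw [Real.exp_neg]
      refine (inv_anti₀ (by linarith) h5).trans ?_
      rw [inv_le_iff_one_le_mul₀ (by linarith)]
      nlinarith [pow_nonneg hz 3]
    have h2 := Real.quadratic_le_exp_of_nonneg (x := Y ω ^ 2 / (4 * c)) (by positivity)
    have h6 : (Y ω ^ 2) ^ 2 ≤ 32 * c ^ 2 * Real.exp (Y ω ^ 2 / (4 * c)) := by
      calc (Y ω ^ 2) ^ 2 = 32 * c ^ 2 * ((Y ω ^ 2 / (4 * c)) ^ 2 / 2) := by field_simp; ring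
        _ ≤ _ := by
          gcongr
          have : 0 ≤ Y ω ^ 2 / (4 * c) := by positivity
          linarith
    have h7 := mul_le_mul_of_nonneg_left h6 (sq_nonneg s)
    nlinarith
  rw [← ofReal_integral_eq_lintegral_ofReal hE
    (Filter.Eventually.of_forall fun ω => (Real.exp_pos _).le)]
  refine ENNReal.ofReal_le_ofReal ?_
  have hle := integral_mono hE (((integrable_const (1 : ℝ)).sub (hYsq.const_mul s)).add
    (hint.const_mul (s ^ 2 * (32 * c ^ 2)))) hb
  have hval : ∫ ω, (1 - s * Y ω ^ 2
      + s ^ 2 * (32 * c ^ 2) * Real.exp (Y ω ^ 2 / (4 * c))) ∂μ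
      = 1 - s + s ^ 2 * (32 * c ^ 2) * ∫ ω, Real.exp (Y ω ^ 2 / (4 * c)) ∂μ := by
    have := integral_const_add_mul_add_mul (a := 1) (b := -s) (d := s ^ 2 * (32 * c ^ 2)) hYsq hint
    simpa only [hvar, mul_one, neg_mul, ← sub_eq_add_neg] using this
  refine hle.trans ((le_of_eq hval).trans ?_)
  have h8 := Real.add_one_le_exp (-s + 96 * c ^ 2 * s ^ 2)
  have h9 := mul_le_mul_of_nonneg_left h3 (by positivity : (0 : ℝ) ≤ s ^ 2 * (32 * c ^ 2))
  linarith

end Subgaussian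

/-! ### Averages of sums of squares over independent blocks -/

section Blocks

variable {Ω : Type*} [MeasurableSpace Ω] {μ : Measure Ω} [IsProbabilityMeasure μ]

/-- Functions of disjoint blocks of an independent family have factorizing expectations. -/
lemma lintegral_prod_of_disjoint_blocks {ι κ : Type*} [DecidableEq ι] {X : ι → Ω → ℝ}
    (hX : ∀ i, Measurable (X i)) (hind : iIndepFun X μ) (S : κ → Finset ι)
    (hS : ∀ i j, i ≠ j → Disjoint (S i) (S j)) (g : ∀ i, (S i → ℝ) → ENNReal)
    (hg : ∀ i, Measurable (g i)) (s : Finset κ) :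
    ∫⁻ ω, ∏ i ∈ s, g i (fun p => X p ω) ∂μ = ∏ i ∈ s, ∫⁻ ω, g i (fun p => X p ω) ∂μ := by
  classical
  induction s using Finset.induction_on with
  | empty => simp
  | insert a s ha ih =>
    simp_rw [Finset.prod_insert ha]
    rw [← ih]
    have hd : Disjoint (S a) (s.biUnion S) := by
      rw [Finset.disjoint_biUnion_right]
      intro i hi
      exact hS a i (by rintro rfl; exact ha hi)
    have hI := hind.indepFun_finset (S a) (s.biUnion S) hd hX
    let G : ({x // x ∈ s.biUnion S} → ℝ) → ENNReal := fun v =>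
      ∏ i : s, g i (fun p => v ⟨p, Finset.mem_biUnion.2 ⟨i, i.2, p.2⟩⟩)
    have hG : Measurable G := by
      refine Finset.measurable_fun_prod _ fun i _ => (hg i).comp ?_
      fun_prop
    have e : ∀ ω, ∏ i ∈ s, g i (fun p => X p ω) = G (fun p => X p ω) := by
      intro ω
      rw [← Finset.prod_coe_sort]
    simp_rw [e]
    have hI2 := hI.comp (hg a) hG
    refine lintegral_mul_eq_lintegral_mul_lintegral_of_indepFun'' ?_ ?_ hI2
    · exact ((hg a).comp (measurable_pi_lambda _ fun p => hX p)).aemeasurable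
    · exact (hG.comp (measurable_pi_lambda _ fun p => hX p)).aemeasurable

/-- The preceding factorization for linear combinations with disjoint supports. -/
lemma lintegral_prod_linear_of_disjoint {ι κ : Type*} [Fintype ι] [Fintype κ] {X : ι → Ω → ℝ}
    (hX : ∀ i, Measurable (X i)) (hind : iIndepFun X μ) (v : κ → ι → ℝ)
    (hv : ∀ i j, i ≠ j → ∀ p, v i p * v j p = 0) {φ : ℝ → ENNReal} (hφ : Measurable φ) :
    ∫⁻ ω, ∏ i, φ (∑ p, v i p * X p ω) ∂μ = ∏ i, ∫⁻ ω, φ (∑ p, v i p * X p ω) ∂μ := by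
  classical
  let S : κ → Finset ι := fun i => Finset.univ.filter fun p => v i p ≠ 0
  have hS : ∀ i j, i ≠ j → Disjoint (S i) (S j) := by
    intro i j hij
    rw [Finset.disjoint_left]
    intro p hp hp'
    simp only [S, Finset.mem_filter, Finset.mem_univ, true_and] at hp hp'
    exact mul_ne_zero hp hp' (hv i j hij p)
  have e : ∀ i ω, ∑ p, v i p * X p ω = ∑ p : S i, v i p * X p ω := by
    intro i ω
    rw [Finset.sum_coe_sort (S i) (fun p => v i p * X p ω), Finset.sum_filter]
    refine Finset.sum_congr rfl fun p _ => ?_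
    by_cases h : v i p = 0 <;> simp [h]
  simp_rw [e]
  exact lintegral_prod_of_disjoint_blocks hX hind S hS
    (fun i u => φ (∑ p : S i, v i p * u p)) (fun i => hφ.comp (by fun_prop)) Finset.univ

omit [IsProbabilityMeasure μ] in
lemma hasSubgaussianMGF_linear {ι : Type*} [Fintype ι] {X : ι → Ω → ℝ} (hind : iIndepFun X μ)
    {c : NNReal} (hsub : ∀ i, HasSubgaussianMGF (X i) c μ) (v : ι → ℝ) (hv : ∑ p, v p ^ 2 = 1) :
    HasSubgaussianMGF (fun ω => ∑ p, v p * X p ω) c μ := by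
  have h1 : iIndepFun (fun p ω => v p * X p ω) μ :=
    hind.comp (fun p x => v p * x) (fun p => by fun_prop)
  have h0 : ∀ p, HasSubgaussianMGF (fun ω => v p * X p ω) (Real.toNNReal (v p ^ 2) * c) μ := by
    intro p
    rw [Real.toNNReal_of_nonneg (sq_nonneg (v p))]
    exact (hsub p).const_mul (v p)
  have h2 := HasSubgaussianMGF.sum_of_iIndepFun (s := Finset.univ) h1 (fun i _ => h0 i)
  rwa [← Finset.sum_mul, ← Real.toNNReal_sum_of_nonneg fun _ _ => sq_nonneg _, hv,
    Real.toNNReal_one, one_mul] at h2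

lemma integral_linear_sq {ι : Type*} [Fintype ι] {X : ι → Ω → ℝ}
    (hind : iIndepFun X μ) {c : NNReal}
    (hsub : ∀ i, HasSubgaussianMGF (X i) c μ) (hmean : ∀ i, ∫ ω, X i ω ∂μ = 0)
    (hvar : ∀ i, variance (X i) μ = 1) (v : ι → ℝ) (hv : ∑ p, v p ^ 2 = 1) :
    ∫ ω, (∑ p, v p * X p ω) ^ 2 ∂μ = 1 := by
  have h1 : iIndepFun (fun p ω => v p * X p ω) μ :=
    hind.comp (fun p x => v p * x) (fun p => by fun_prop)
  have hL : ∀ p, MemLp (fun ω => v p * X p ω) 2 μ := fun p => ((hsub p).memLp 2).const_mul (v p)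
  have h2 := IndepFun.variance_sum (s := Finset.univ) (fun p _ => hL p)
    (fun i _ j _ hij => h1.indepFun hij)
  have h3 : ∫ ω, (∑ p, fun ω => v p * X p ω) ω ∂μ = 0 := by
    simp only [Finset.sum_apply]
    rw [integral_finsetSum _ fun p _ => (hL p).integrable (by norm_num)]
    simp [integral_const_mul, hmean]
  rw [variance_of_integral_eq_zero (Finset.aemeasurable_sum _ fun p _ => (hL p).aemeasurable) h3]
    at h2
  simp only [Finset.sum_apply] at h2
  rw [h2, ← hv]
  refine Finset.sum_congr rfl fun p _ => ?_
  rw [variance_const_mul, hvar, mul_one]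

/-- Chernoff's bound for an average: by convexity of `exp`, no independence between the averaged
quantities is needed. -/
lemma measureReal_le_mul_avg_le {w : ℕ} (hw : 0 < w) {F : Fin w → Ω → ℝ}
    (hF : ∀ a, Measurable (F a)) {t B : ℝ} (hB : 0 ≤ B)
    (h : ∀ a, ∫⁻ ω, ENNReal.ofReal (Real.exp (t * F a ω)) ∂μ ≤ ENNReal.ofReal B) (u : ℝ) :
    μ.real {ω | u ≤ t * ((w : ℝ)⁻¹ * ∑ a, F a ω)} ≤ B * Real.exp (-u) := by
  have hw' : (0 : ℝ) < w := by exact_mod_cast hw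
  have hJ : ∀ ω, Real.exp (t * ((w : ℝ)⁻¹ * ∑ a, F a ω))
      ≤ ∑ a, (w : ℝ)⁻¹ * Real.exp (t * F a ω) := by
    intro ω
    have := convexOn_exp.map_sum_le (t := (Finset.univ : Finset (Fin w))) (w := fun _ => (w : ℝ)⁻¹)
      (p := fun a => t * F a ω) (fun _ _ => by positivity)
      (by simp [mul_inv_cancel₀ hw'.ne']) (fun _ _ => Set.mem_univ _)
    simp only [smul_eq_mul] at this
    refine le_trans (le_of_eq ?_) this
    congr 1
    rw [Finset.mul_sum, Finset.mul_sum]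
    exact Finset.sum_congr rfl fun _ _ => by ring
  have hI : ∫⁻ ω, ENNReal.ofReal (Real.exp (t * ((w : ℝ)⁻¹ * ∑ a, F a ω))) ∂μ
      ≤ ENNReal.ofReal B := by
    calc _ ≤ ∫⁻ ω, ∑ a, ENNReal.ofReal (w : ℝ)⁻¹ * ENNReal.ofReal (Real.exp (t * F a ω)) ∂μ := by
          refine lintegral_mono fun ω => (ENNReal.ofReal_le_ofReal (hJ ω)).trans (le_of_eq ?_)
          rw [ENNReal.ofReal_sum_of_nonneg fun _ _ => by positivity]
          exact Finset.sum_congr rfl fun _ _ => ENNReal.ofReal_mul (by positivity)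
      _ = ∑ a, ENNReal.ofReal (w : ℝ)⁻¹ * ∫⁻ ω, ENNReal.ofReal (Real.exp (t * F a ω)) ∂μ := by
          rw [lintegral_finsetSum _ fun a _ => by fun_prop]
          exact Finset.sum_congr rfl fun a _ => lintegral_const_mul _ (by fun_prop)
      _ ≤ ∑ a : Fin w, ENNReal.ofReal (w : ℝ)⁻¹ * ENNReal.ofReal B := by
          gcongr with a; exact h a
      _ = ENNReal.ofReal B := by
          rw [Finset.sum_const, ← ENNReal.ofReal_mul (by positivity), nsmul_eq_mul,
            Finset.card_univ, Fintype.card_fin, ← ENNReal.ofReal_natCast,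
            ← ENNReal.ofReal_mul (by positivity), mul_inv_cancel_left₀ hw'.ne']
  have hM := mul_meas_ge_le_lintegral₀ (μ := μ)
    (f := fun ω => ENNReal.ofReal (Real.exp (t * ((w : ℝ)⁻¹ * ∑ a, F a ω)))) (by fun_prop)
    (ENNReal.ofReal (Real.exp u))
  have hset : {ω | u ≤ t * ((w : ℝ)⁻¹ * ∑ a, F a ω)} ⊆ {ω | ENNReal.ofReal (Real.exp u)
      ≤ ENNReal.ofReal (Real.exp (t * ((w : ℝ)⁻¹ * ∑ a, F a ω)))} := fun ω hω =>
    ENNReal.ofReal_le_ofReal (Real.exp_le_exp.2 hω)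
  have h4 : ENNReal.ofReal (Real.exp u * μ.real {ω | u ≤ t * ((w : ℝ)⁻¹ * ∑ a, F a ω)})
      ≤ ENNReal.ofReal B := by
    rw [ENNReal.ofReal_mul (Real.exp_pos _).le, ofReal_measureReal]
    exact (mul_le_mul_right (measure_mono hset) _).trans (hM.trans hI)
  have h5 := (ENNReal.ofReal_le_ofReal_iff hB).1 h4
  rw [Real.exp_neg, ← div_eq_mul_inv, le_div_iff₀ (Real.exp_pos _)]
  linarith

variable {ι : Type*} [Fintype ι] {X : ι → Ω → ℝ}

omit [IsProbabilityMeasure μ] in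
/-- Let `Q` be an average over `a` of sums over `i < n` of squares of normalized linear
combinations of independent unit-variance subgaussian variables; for fixed `a` the combinations
involve disjoint blocks. Then `Q / n` is bounded below and above, except with exponentially small
probability. -/
lemma measureReal_avg_sum_sq (hX : ∀ i, Measurable (X i)) (hind : iIndepFun X μ)
    {c : NNReal} (hc : 0 < c) (hsub : ∀ i, HasSubgaussianMGF (X i) c μ)
    (hmean : ∀ i, ∫ ω, X i ω ∂μ = 0) (hvar : ∀ i, variance (X i) μ = 1)
    {w n : ℕ} (hw : 0 < w) (v : Fin w → Fin n → ι → ℝ) (hv1 : ∀ a i, ∑ p, v a i p ^ 2 = 1)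
    (hv2 : ∀ a i j, i ≠ j → ∀ p, v a i p * v a j p = 0) :
    μ.real {ω | (w : ℝ)⁻¹ * ∑ a, ∑ i, (∑ p, v a i p * X p ω) ^ 2 ≤ n / 4}
        ≤ Real.exp (-(n / (768 * c ^ 2))) ∧
    μ.real {ω | 12 * c * n ≤ (w : ℝ)⁻¹ * ∑ a, ∑ i, (∑ p, v a i p * X p ω) ^ 2}
        ≤ Real.exp (-n) := by
  have hc' : (0 : ℝ) < c := hc
  have := hind.isProbabilityMeasure
  let F : Fin w → Ω → ℝ := fun a ω => ∑ i, (∑ p, v a i p * X p ω) ^ 2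
  have hF : ∀ a, Measurable (F a) := fun a => by fun_prop
  have hprod : ∀ (t : ℝ) a, ∫⁻ ω, ENNReal.ofReal (Real.exp (t * F a ω)) ∂μ
      = ∏ i, ∫⁻ ω, ENNReal.ofReal (Real.exp (t * (∑ p, v a i p * X p ω) ^ 2)) ∂μ := by
    intro t a
    rw [← lintegral_prod_linear_of_disjoint hX hind (v a) (hv2 a)
      (φ := fun y => ENNReal.ofReal (Real.exp (t * y ^ 2))) (by fun_prop)]
    refine lintegral_congr fun ω => ?_
    rw [← ENNReal.ofReal_prod_of_nonneg fun _ _ => (Real.exp_pos _).le, ← Real.exp_sum,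
      Finset.mul_sum]
  have hY : ∀ a i, HasSubgaussianMGF (fun ω => ∑ p, v a i p * X p ω) c μ := fun a i =>
    hasSubgaussianMGF_linear hind hsub _ (hv1 a i)
  constructor
  · -- the exponent `s` balances the linear gain against the quadratic loss
    set s : ℝ := 1 / (192 * c ^ 2) with hs
    have hs0 : 0 < s := by positivity
    have hB : ∀ a, ∫⁻ ω, ENNReal.ofReal (Real.exp (-s * F a ω)) ∂μ
        ≤ ENNReal.ofReal (Real.exp (-s + 96 * c ^ 2 * s ^ 2) ^ n) := by
      intro a
      rw [hprod, ENNReal.ofReal_pow (Real.exp_pos _).le]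
      refine (Finset.prod_le_pow_card _ _
        (ENNReal.ofReal (Real.exp (-s + 96 * c ^ 2 * s ^ 2))) fun i _ => ?_).trans (by simp)
      have := lintegral_exp_neg_sq_le hc (by fun_prop) (hY a i)
        (integral_linear_sq hind hsub hmean hvar _ (hv1 a i)) hs0.le
      simpa only [neg_mul] using this
    have := measureReal_le_mul_avg_le hw hF (by positivity) hB (-s * (n / 4))
    have hset : {ω | (w : ℝ)⁻¹ * ∑ a, ∑ i, (∑ p, v a i p * X p ω) ^ 2 ≤ n / 4}
        ⊆ {ω | -s * (n / 4) ≤ -s * ((w : ℝ)⁻¹ * ∑ a, F a ω)} := by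
      intro ω hω
      simp only [Set.mem_ofPred_eq] at hω ⊢
      have := mul_le_mul_of_nonneg_left hω hs0.le
      simp only [F]
      linarith
    refine (measureReal_mono hset).trans (this.trans (le_of_eq ?_))
    rw [← Real.exp_nat_mul, ← Real.exp_add, hs]
    congr 1
    field_simp
    ring
  · have hB : ∀ a, ∫⁻ ω, ENNReal.ofReal (Real.exp (1 / (4 * c) * F a ω)) ∂μ
        ≤ ENNReal.ofReal (3 ^ n) := by
      intro a
      rw [hprod, ENNReal.ofReal_pow (by norm_num)]
      refine (Finset.prod_le_pow_card _ _ (ENNReal.ofReal 3) fun i _ => ?_).trans (by simp)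
      have := lintegral_exp_sq_le_of_hasSubgaussianMGF hc (by fun_prop) (hY a i)
      simpa [div_eq_inv_mul] using this
    have := measureReal_le_mul_avg_le hw hF (by positivity) hB (3 * n)
    have hset : {ω | 12 * c * n ≤ (w : ℝ)⁻¹ * ∑ a, ∑ i, (∑ p, v a i p * X p ω) ^ 2}
        ⊆ {ω | 3 * n ≤ 1 / (4 * c) * ((w : ℝ)⁻¹ * ∑ a, F a ω)} := by
      intro ω hω
      simp only [Set.mem_ofPred_eq] at hω ⊢
      rw [div_mul_eq_mul_div, le_div_iff₀ (by positivity)]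
      simp only [F]
      linarith
    refine (measureReal_mono hset).trans (this.trans ?_)
    have h3 : (3 : ℝ) ≤ Real.exp 2 := by
      have := Real.add_one_le_exp (2 : ℝ); linarith
    calc (3 : ℝ) ^ n * Real.exp (-(3 * n)) ≤ Real.exp 2 ^ n * Real.exp (-(3 * n)) := by gcongr
      _ = Real.exp (-n) := by
        rw [← Real.exp_nat_mul, ← Real.exp_add]; congr 1; ring

end Blocks

/-! ### Euclidean norms -/

section Euclidean

variable {ι κ : Type*} [Fintype ι]

lemma l2norm_sq (v : ι → ℝ) : l2norm v ^ 2 = ∑ i, v i ^ 2 := by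
  simp [l2norm, EuclideanSpace.norm_sq_eq]

lemma l2norm_nonneg (v : ι → ℝ) : 0 ≤ l2norm v := norm_nonneg _

lemma l2norm_add_le (v w : ι → ℝ) : l2norm (v + w) ≤ l2norm v + l2norm w := by
  simpa [l2norm] using norm_add_le (WithLp.toLp 2 v) (WithLp.toLp 2 w)

lemma l2norm_sub_le (v w : ι → ℝ) : l2norm (v - w) ≤ l2norm v + l2norm w := by
  simpa [l2norm] using norm_sub_le (WithLp.toLp 2 v) (WithLp.toLp 2 w)

lemma abs_le_l2norm (v : ι → ℝ) (i : ι) : |v i| ≤ l2norm v := by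
  simpa [l2norm] using PiLp.norm_apply_le (WithLp.toLp 2 v) i

lemma l2norm_le_of_sq_le {v : ι → ℝ} {t : ℝ} (ht : 0 ≤ t) (h : ∑ i, v i ^ 2 ≤ t ^ 2) :
    l2norm v ≤ t := by
  rw [← l2norm_sq] at h
  exact (pow_le_pow_iff_left₀ (l2norm_nonneg v) ht two_ne_zero).1 h

lemma measurable_l2norm : Measurable (l2norm : (ι → ℝ) → ℝ) := by
  unfold l2norm; fun_prop

/-- Extension by zero of a vector indexed by `T`. -/
def extendZero {N : ℕ} {T : Finset (Fin N)} (u : T → ℝ) : Fin N → ℝ :=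
  fun j => if h : j ∈ T then u ⟨j, h⟩ else 0

lemma sum_extendZero {N : ℕ} {T : Finset (Fin N)} (u : T → ℝ) (g : Fin N → ℝ → ℝ)
    (hg : ∀ j, g j 0 = 0) : ∑ j, g j (extendZero u j) = ∑ j : T, g j (u j) := by
  rw [← Finset.sum_subset (Finset.subset_univ T) (fun j _ hj => by simp [extendZero, hj, hg]),
    ← Finset.sum_coe_sort T]
  exact Finset.sum_congr rfl fun j _ => by simp [extendZero]

lemma l2norm_extendZero {N : ℕ} {T : Finset (Fin N)} (u : T → ℝ) :
    l2norm (extendZero u) = l2norm u := by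
  rw [← pow_left_inj₀ (l2norm_nonneg _) (l2norm_nonneg _) two_ne_zero, l2norm_sq, l2norm_sq]
  exact sum_extendZero u (fun _ t => t ^ 2) (by simp)

lemma submatrix_mulVec_extendZero {N : ℕ} (A : Matrix κ (Fin N) ℝ) {T : Finset (Fin N)}
    (u : T → ℝ) : (A.submatrix id Subtype.val).mulVec u = A.mulVec (extendZero u) := by
  ext i
  exact (sum_extendZero u (fun j t => A i j * t) (by simp)).symm

lemma extendZero_restrict {N : ℕ} {T : Finset (Fin N)} {x : Fin N → ℝ}
    (hx : ∀ j, x j ≠ 0 → j ∈ T) : extendZero (fun j : T => x j) = x := by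
  ext j
  by_cases h : j ∈ T
  · simp [extendZero, h]
  · simp [extendZero, h]; by_contra h'; exact h (hx j (Ne.symm h'))

end Euclidean

/-! ### Nets of the unit sphere -/

section Nets

variable {E F : Type*} [NormedAddCommGroup E] [NormedSpace ℝ E] [FiniteDimensional ℝ E]
  [NormedAddCommGroup F] [NormedSpace ℝ F]

/-- The volume bound for separated subsets of the unit ball. -/
lemma card_le_of_separated {ε : ℝ} (hε : 0 < ε) (s : Finset E) (hs : ∀ x ∈ s, ‖x‖ ≤ 1)
    (h : ∀ x ∈ s, ∀ y ∈ s, x ≠ y → ε ≤ ‖x - y‖) :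
    (s.card : ℝ) ≤ (1 + 2 / ε) ^ Module.finrank ℝ E := by
  borelize E
  let μ : Measure E := Measure.addHaar
  have hδ : 0 < ε / 2 := by positivity
  have hR : 0 < 1 + ε / 2 := by positivity
  have hD : Set.Pairwise (s : Set E) (Function.onFun Disjoint fun x => Metric.ball x (ε / 2)) := by
    rintro x hx y hy hxy
    apply Metric.ball_disjoint_ball
    rw [dist_eq_norm]
    linarith [h x hx y hy hxy]
  have hsub : (⋃ x ∈ s, Metric.ball x (ε / 2)) ⊆ Metric.ball (0 : E) (1 + ε / 2) := by
    refine Set.iUnion₂_subset fun x hx => Metric.ball_subset_ball' ?_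
    rw [dist_zero_right]; linarith [hs x hx]
  have I : (s.card : ENNReal) * ENNReal.ofReal ((ε / 2) ^ Module.finrank ℝ E)
      * μ (Metric.ball 0 1)
      ≤ ENNReal.ofReal ((1 + ε / 2) ^ Module.finrank ℝ E) * μ (Metric.ball 0 1) := by
    calc _ = μ (⋃ x ∈ s, Metric.ball x (ε / 2)) := by
          rw [measure_biUnion_finset hD fun x _ => measurableSet_ball]
          simp only [μ.addHaar_ball_of_pos _ hδ, Finset.sum_const, nsmul_eq_mul, mul_assoc]
      _ ≤ μ (Metric.ball 0 (1 + ε / 2)) := measure_mono hsub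
      _ = _ := by rw [μ.addHaar_ball_of_pos _ hR]
  have J := (ENNReal.mul_le_mul_iff_left
    (Metric.measure_ball_pos μ (0 : E) zero_lt_one).ne' measure_ball_lt_top.ne).1 I
  have K := ENNReal.toReal_le_of_le_ofReal (by positivity) J
  rw [ENNReal.toReal_mul, ENNReal.toReal_natCast, ENNReal.toReal_ofReal (by positivity)] at K
  rw [← le_div_iff₀ (by positivity), ← div_pow] at K
  refine K.trans (le_of_eq ?_)
  congr 1
  field_simp
  ring

/-- The unit sphere has an `ε`-net of cardinality at most `(1 + 2 / ε) ^ dim`. -/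
lemma exists_net {ε : ℝ} (hε : 0 < ε) : ∃ s : Finset E,
    (s.card : ℝ) ≤ (1 + 2 / ε) ^ Module.finrank ℝ E ∧ (∀ x ∈ s, ‖x‖ = 1) ∧
    ∀ x : E, ‖x‖ = 1 → ∃ y ∈ s, ‖x - y‖ < ε := by
  classical
  let P : Finset E → Prop := fun s => (∀ x ∈ s, ‖x‖ = 1) ∧
    ∀ x ∈ s, ∀ y ∈ s, x ≠ y → ε ≤ ‖x - y‖
  have hb : ∀ s, P s → (s.card : ℝ) ≤ (1 + 2 / ε) ^ Module.finrank ℝ E := fun s hs =>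
    card_le_of_separated hε s (fun x hx => (hs.1 x hx).le) hs.2
  let C : Set ℕ := {n | ∃ s, P s ∧ s.card = n}
  have hC : C.Nonempty := ⟨0, ∅, by simp [P], rfl⟩
  have hC2 : BddAbove C := by
    refine ⟨⌊(1 + 2 / ε) ^ Module.finrank ℝ E⌋₊, ?_⟩
    rintro n ⟨s, hs, rfl⟩
    exact Nat.le_floor (hb s hs)
  obtain ⟨s, hs, hcard⟩ := Nat.sSup_mem hC hC2
  refine ⟨s, hb s hs, hs.1, fun x hx => ?_⟩
  by_contra! hcon
  have hxs : x ∉ s := fun h => by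
    have := hcon x h
    simp at this
    linarith
  have hP : P (insert x s) := by
    constructor
    · intro y hy
      rcases Finset.mem_insert.1 hy with rfl | hy
      exacts [hx, hs.1 y hy]
    · intro y hy z hz hyz
      rcases Finset.mem_insert.1 hy with hy | hy <;> rcases Finset.mem_insert.1 hz with hz | hz
      · exact absurd (hy.trans hz.symm) hyz
      · rw [hy]; exact hcon z hz
      · rw [hz, norm_sub_rev]; exact hcon y hy
      · exact hs.2 y hy z hz hyz
  have := le_csSup hC2 (show (insert x s).card ∈ C from ⟨_, hP, rfl⟩)
  rw [Finset.card_insert_of_notMem hxs] at this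
  omega

omit [FiniteDimensional ℝ E] in
/-- Two-sided bounds for a linear map on a fine net extend to the whole space. -/
lemma norm_bounds_of_net (f : E →L[ℝ] F) {s : Finset E} {ε a b : ℝ} (hb : 0 ≤ b)
    (hε : ε ≤ 1 / 2) (hε2 : 4 * b * ε ≤ a)
    (hs : ∀ x : E, ‖x‖ = 1 → ∃ y ∈ s, ‖x - y‖ < ε)
    (hf : ∀ y ∈ s, a ≤ ‖f y‖ ∧ ‖f y‖ ≤ b) (x : E) :
    a / 2 * ‖x‖ ≤ ‖f x‖ ∧ ‖f x‖ ≤ 2 * b * ‖x‖ := by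
  have hop : ‖f‖ ≤ 2 * b := by
    have : ‖f‖ ≤ b + ε * ‖f‖ := by
      by_cases hε0 : 0 ≤ ε
      · refine f.opNorm_le_of_unit_norm (by positivity) fun x hx => ?_
        obtain ⟨y, hy, hxy⟩ := hs x hx
        calc ‖f x‖ = ‖f y + f (x - y)‖ := by rw [← map_add]; congr 2; abel
          _ ≤ ‖f y‖ + ‖f (x - y)‖ := norm_add_le _ _
          _ ≤ b + ‖f‖ * ‖x - y‖ := add_le_add (hf y hy).2 (f.le_opNorm _)
          _ ≤ b + ε * ‖f‖ := by rw [mul_comm]; gcongr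
      · -- without unit vectors the space is trivial
        have hn : ∀ x : E, ‖x‖ = 1 → False := fun x hx => by
          obtain ⟨y, _, hxy⟩ := hs x hx
          linarith [norm_nonneg (x - y)]
        have : ‖f‖ ≤ 0 := f.opNorm_le_of_unit_norm le_rfl fun x hx => (hn x hx).elim
        have h0 : ‖f‖ = 0 := le_antisymm this (norm_nonneg _)
        rw [h0]; linarith
    nlinarith [norm_nonneg f]
  refine ⟨?_, (f.le_opNorm x).trans (by gcongr)⟩
  rcases eq_or_ne x 0 with rfl | hx
  · simp
  have hx0 : 0 < ‖x‖ := norm_pos_iff.2 hx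
  obtain ⟨y, hy, hxy⟩ := hs (‖x‖⁻¹ • x) (by rw [norm_smul, norm_inv, norm_norm,
    inv_mul_cancel₀ hx0.ne'])
  have h1 : a ≤ ‖f (‖x‖⁻¹ • x)‖ + 2 * b * ε := by
    calc a ≤ ‖f y‖ := (hf y hy).1
      _ = ‖f (‖x‖⁻¹ • x) - f (‖x‖⁻¹ • x - y)‖ := by rw [← map_sub]; congr 2; abel
      _ ≤ ‖f (‖x‖⁻¹ • x)‖ + ‖f (‖x‖⁻¹ • x - y)‖ := norm_sub_le _ _
      _ ≤ _ := by
        gcongr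
        exact (f.le_opNorm _).trans (by gcongr)
  have h2 : a / 2 ≤ ‖f (‖x‖⁻¹ • x)‖ := by linarith
  rw [map_smul, norm_smul, norm_inv, norm_norm, inv_mul_eq_div, le_div_iff₀ hx0] at h2
  exact h2

end Nets

/-! ### Uniform bounds over sparse vectors -/

section Sparse

lemma choose_le_exp_pow {N s : ℕ} (hs : 1 ≤ s) :
    (N.choose s : ℝ) ≤ (Real.exp 1 * N / s) ^ s := by
  have hs0 : (0 : ℝ) < s := by exact_mod_cast hs
  have h1 : (N.choose s : ℝ) ≤ (N : ℝ) ^ s / s.factorial := Nat.choose_le_pow_div s N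
  have h2 := Real.pow_div_factorial_le_exp (s : ℝ) hs0.le s
  have h3 : (0 : ℝ) < s.factorial := by exact_mod_cast s.factorial_pos
  refine h1.trans ?_
  rw [div_pow, mul_pow, ← Real.exp_nat_mul, mul_one]
  rw [div_le_div_iff₀ h3 (by positivity)]
  rw [div_le_iff₀ h3] at h2
  nlinarith [pow_nonneg (Nat.cast_nonneg (α := ℝ) N) s]

variable {Ω : Type*} [MeasurableSpace Ω] {μ : Measure Ω}
  {κ : Type*} [Fintype κ] {N : ℕ}

/-- A random matrix that maps each fixed unit vector, with overwhelming probability, to a vector of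
norm between `a` and `b`, does so up to a factor `2` for all sparse vectors simultaneously. -/
lemma exists_event_sparse_bounds {Ψ : Ω → Matrix κ (Fin N) ℝ}
    (hΨ : ∀ i j, Measurable fun ω => Ψ ω i j) {a b ε p : ℝ} (hb : 0 ≤ b) (hp : 0 ≤ p) (hε0 : 0 < ε)
    (hε : ε ≤ 1 / 2) (hε2 : 4 * b * ε ≤ a)
    (hlow : ∀ x : Fin N → ℝ, l2norm x = 1 → μ.real {ω | l2norm ((Ψ ω).mulVec x) ≤ a} ≤ p)
    (hupp : ∀ x : Fin N → ℝ, l2norm x = 1 → μ.real {ω | b ≤ l2norm ((Ψ ω).mulVec x)} ≤ p)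
    {s : ℕ} (hsN : s ≤ N) :
    ∃ E : Set Ω, MeasurableSet E ∧
      μ.real Eᶜ ≤ N.choose s * ((1 + 2 / ε) ^ s * (2 * p)) ∧
      ∀ ω ∈ E, ∀ x : Fin N → ℝ, IsSparse s x →
        a / 2 * l2norm x ≤ l2norm ((Ψ ω).mulVec x) ∧
        l2norm ((Ψ ω).mulVec x) ≤ 2 * b * l2norm x := by
  classical
  -- one net for each support of size `s`, and the event that all net points behave well
  choose net hnet1 hnet2 hnet3 using fun T : Finset (Fin N) =>
    exists_net (E := EuclideanSpace ℝ T) hε0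
  have hmeas : ∀ x : Fin N → ℝ, Measurable fun ω => l2norm ((Ψ ω).mulVec x) := by
    intro x
    refine measurable_l2norm.comp (measurable_pi_lambda _ fun i => ?_)
    simp only [Matrix.mulVec, dotProduct]
    fun_prop
  let B : (T : Finset (Fin N)) → EuclideanSpace ℝ T → Set Ω := fun T y =>
    {ω | l2norm ((Ψ ω).mulVec (extendZero y.ofLp)) ≤ a} ∪
    {ω | b ≤ l2norm ((Ψ ω).mulVec (extendZero y.ofLp))}
  have hB : ∀ T y, MeasurableSet (B T y) := fun T y =>
    (measurableSet_le (hmeas _) measurable_const).union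
      (measurableSet_le measurable_const (hmeas _))
  have hBp : ∀ T, ∀ y ∈ net T, μ.real (B T y) ≤ 2 * p := by
    intro T y hy
    have h1 : l2norm (extendZero y.ofLp) = 1 := by
      rw [l2norm_extendZero]; exact hnet2 T y hy
    refine (measureReal_union_le _ _).trans ?_
    linarith [hlow _ h1, hupp _ h1]
  refine ⟨(⋃ T ∈ Finset.powersetCard s Finset.univ, ⋃ y ∈ net T, B T y)ᶜ, ?_, ?_, ?_⟩
  · exact (Finset.measurableSet_biUnion _ fun T _ =>
      Finset.measurableSet_biUnion _ fun y _ => hB T y).compl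
  · rw [compl_compl]
    refine (measureReal_biUnion_finset_le _ _).trans ?_
    have h2 : ∀ T ∈ Finset.powersetCard s (Finset.univ : Finset (Fin N)),
        μ.real (⋃ y ∈ net T, B T y) ≤ (1 + 2 / ε) ^ s * (2 * p) := by
      intro T hT
      rw [Finset.mem_powersetCard] at hT
      refine (measureReal_biUnion_finset_le _ _).trans ?_
      refine (Finset.sum_le_card_nsmul _ _ _ (hBp T)).trans ?_
      rw [nsmul_eq_mul]
      have h3 := hnet1 T
      rw [finrank_euclideanSpace, Fintype.card_coe, hT.2] at h3
      gcongr
    refine (Finset.sum_le_card_nsmul _ _ _ h2).trans ?_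
    rw [nsmul_eq_mul, Finset.card_powersetCard, Finset.card_univ, Fintype.card_fin]
  · intro ω hω x hx
    simp only [Set.mem_compl_iff, Set.mem_iUnion, not_exists] at hω
    obtain ⟨T, hT1, hT2⟩ := Finset.exists_superset_card_eq hx (by simpa using hsN)
    let A : Matrix κ T ℝ := (Ψ ω).submatrix id Subtype.val
    let f : EuclideanSpace ℝ T →L[ℝ] EuclideanSpace ℝ κ :=
      LinearMap.toContinuousLinearMap (Matrix.toEuclideanLin A)
    have hf : ∀ u, ‖f u‖ = l2norm ((Ψ ω).mulVec (extendZero u.ofLp)) := by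
      intro u
      rw [← submatrix_mulVec_extendZero]; rfl
    have key := norm_bounds_of_net f hb hε hε2 (hnet3 T) (fun y hy => by
      have := hω T (Finset.mem_powersetCard.2 ⟨Finset.subset_univ _, hT2⟩) y hy
      simp only [B, Set.mem_union, Set.mem_ofPred_eq, not_or, not_le] at this
      rw [hf]
      exact ⟨this.1.le, this.2.le⟩) (WithLp.toLp 2 fun j : T => x j)
    rw [hf] at key
    have hxT : extendZero (fun j : T => x j) = x :=
      extendZero_restrict fun j hj => hT1 (by simpa using hj)
    have hn : ‖WithLp.toLp 2 fun j : T => x j‖ = l2norm x := by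
      rw [← hxT, l2norm_extendZero, hxT]; rfl
    rw [hn] at key
    simpa only [hxT] using key

end Sparse

/-! ### Filtered measurements -/

section Filtered

universe u

/-- The energy of a signal `y` after filtering, averaged over `w` filters: `V a i` is the `i`th row
of the `a`th filter. -/
noncomputable def filteredEnergy {w n m : ℕ} (V : Fin w → Fin n → Fin m → ℝ) (y : Fin m → ℝ) : ℝ :=
  (w : ℝ)⁻¹ * ∑ a, ∑ i, (∑ p, V a i p * y p) ^ 2

/-- The failure probability `2 exp (-γ n)` of a single net point beats a net of `K ^ s` points on each
of `exp (s t)` supports, once `n` exceeds a multiple of `s t`. -/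
lemma union_bound_numerics {γ K t n s : ℝ} (hγ : 0 < γ) (hK : 1 ≤ K) (ht : 1 ≤ t) (hs : 1 ≤ s)
    (h : 2 / γ * (Real.log 4 + 1 + Real.log K) * (s * t) ≤ n) :
    Real.exp (s * t) * (Real.exp (s * Real.log K) * (2 * Real.exp (-(γ * n))))
      ≤ 1 / 2 * Real.exp (-(γ / 2 * n)) := by
  have h4 : (4 : ℝ) = Real.exp (Real.log 4) := (Real.exp_log (by norm_num)).symm
  have hl4 : 0 ≤ Real.log 4 := Real.log_nonneg (by norm_num)
  have hlK : 0 ≤ Real.log K := Real.log_nonneg hK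
  have h1 : 2 * (Real.log 4 + 1 + Real.log K) * (s * t) ≤ γ * n := by
    have := mul_le_mul_of_nonneg_left h hγ.le
    calc _ = γ * (2 / γ * (Real.log 4 + 1 + Real.log K) * (s * t)) := by field_simp
      _ ≤ _ := this
  have hst : 1 ≤ s * t := one_le_mul_of_one_le_of_one_le hs ht
  have hst2 : s ≤ s * t := le_mul_of_one_le_right (by linarith) ht
  have h2 : Real.log 4 + s * t + s * Real.log K ≤ γ / 2 * n := by
    have e1 : Real.log 4 ≤ Real.log 4 * (s * t) := le_mul_of_one_le_right hl4 hst
    have e2 : s * Real.log K ≤ s * t * Real.log K := by gcongr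
    linarith
  have h3 : 4 * (Real.exp (s * t) * (Real.exp (s * Real.log K) * Real.exp (-(γ * n))))
      ≤ Real.exp (-(γ / 2 * n)) := by
    nth_rewrite 1 [h4]
    rw [← Real.exp_add, ← Real.exp_add, ← Real.exp_add, Real.exp_le_exp]
    linarith
  linarith

lemma one_le_log_exp_mul_div {N s : ℕ} (hs : 1 ≤ s) (hsN : s ≤ N) :
    1 ≤ Real.log (Real.exp 1 * N / s) := by
  have hs0 : (0 : ℝ) < s := by exact_mod_cast hs
  have h : (s : ℝ) ≤ N := by exact_mod_cast hsN
  have hN0 : (0 : ℝ) < N := hs0.trans_le h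
  rw [Real.le_log_iff_exp_le (by positivity), mul_div_assoc]
  exact le_mul_of_one_le_right (Real.exp_pos _).le ((one_le_div hs0).2 h)

/-- With overwhelming probability the filtered energy of `Φ x` is comparable to `n ‖x‖²` for all
`s`-sparse `x`, as soon as `n` exceeds a multiple of `s log (eN / s)`. -/
theorem exists_event_filteredEnergy_bounds (c : NNReal) (hc : 0 < c) :
    ∃ C₀ γ : ℝ, 0 < C₀ ∧ 0 < γ ∧
      ∀ (Ω : Type u) [MeasurableSpace Ω] (μ : Measure Ω)
        {m N n w s : ℕ} (Φ : Ω → Matrix (Fin m) (Fin N) ℝ),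
        (∀ i j, Measurable fun ω => Φ ω i j) →
        iIndepFun (fun (p : Fin m × Fin N) ω => Φ ω p.1 p.2) μ →
        (∀ i j, ∫ ω, Φ ω i j ∂μ = 0) →
        (∀ i j, variance (fun ω => Φ ω i j) μ = 1) →
        (∀ i j, HasSubgaussianMGF (fun ω => Φ ω i j) c μ) →
        0 < w → 1 ≤ s → s ≤ N →
        ∀ (V : Fin w → Fin n → Fin m → ℝ), (∀ a i, ∑ p, V a i p ^ 2 = 1) →
        (∀ a i j, i ≠ j → ∀ p, V a i p * V a j p = 0) →
        C₀ * (s * Real.log (Real.exp 1 * N / s)) ≤ n →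
        ∃ E : Set Ω, MeasurableSet E ∧ μ.real Eᶜ ≤ 1 / 2 * Real.exp (-(γ * n)) ∧
          ∀ ω ∈ E, ∀ x : Fin N → ℝ, IsSparse s x →
            n / 16 * l2norm x ^ 2 ≤ filteredEnergy V ((Φ ω).mulVec x) ∧
            filteredEnergy V ((Φ ω).mulVec x) ≤ 48 * c * n * l2norm x ^ 2 := by
  have hc' : (0 : ℝ) < c := hc
  -- `ε` makes the upper bound `√(12 c n)` and the lower bound `√n / 2` compatible on an `ε`-net
  set ε : ℝ := min (1 / 2) (1 / (8 * √(12 * c)))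
  have hε0 : 0 < ε := by positivity
  set γ : ℝ := min 1 (1 / (768 * c ^ 2))
  have hγ : 0 < γ := by positivity
  have hK : 1 ≤ 1 + 2 / ε := le_add_of_nonneg_right (by positivity)
  have hlK := Real.log_nonneg hK
  have hl4 : 0 ≤ Real.log 4 := Real.log_nonneg (by norm_num)
  refine ⟨2 / γ * (Real.log 4 + 1 + Real.log (1 + 2 / ε)), γ / 2, by positivity, by positivity, ?_⟩
  intro Ω _ μ m N n w s Φ hmeas hind hmean hvar hsub hw hs hsN V hV1 hV2 hn
  have := hind.isProbabilityMeasure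
  have hw' : (0 : ℝ) < w := by exact_mod_cast hw
  let Ψ : Ω → Matrix (Fin w × Fin n) (Fin N) ℝ := fun ω =>
    Matrix.of fun q j => (√(w : ℝ))⁻¹ * ∑ p, V q.1 q.2 p * Φ ω p j
  have hΨ : ∀ ω (x : Fin N → ℝ), l2norm ((Ψ ω).mulVec x) ^ 2
      = filteredEnergy V ((Φ ω).mulVec x) := by
    intro ω x
    rw [l2norm_sq, filteredEnergy, Fintype.sum_prod_type, Finset.mul_sum]
    refine Finset.sum_congr rfl fun a _ => ?_
    rw [Finset.mul_sum]
    refine Finset.sum_congr rfl fun i _ => ?_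
    have : (Ψ ω).mulVec x (a, i) = (√(w : ℝ))⁻¹ * ∑ p, V a i p * (Φ ω).mulVec x p := by
      simp only [Ψ, Matrix.mulVec, dotProduct, Matrix.of_apply]
      simp_rw [mul_assoc, ← Finset.mul_sum, Finset.sum_mul, Finset.mul_sum]
      rw [Finset.sum_comm]
      simp_rw [mul_assoc]
    rw [this, mul_pow, inv_pow, Real.sq_sqrt hw'.le]
  -- the filtered measurements as linear combinations of the entries of `Φ`
  have hlin : ∀ (x : Fin N → ℝ) ω, filteredEnergy V ((Φ ω).mulVec x)
      = (w : ℝ)⁻¹ * ∑ a, ∑ i, (∑ q : Fin m × Fin N, (V a i q.1 * x q.2) * Φ ω q.1 q.2) ^ 2 := by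
    intro x ω
    simp only [filteredEnergy, Matrix.mulVec, dotProduct, Fintype.sum_prod_type, Finset.mul_sum]
    congr! 6
    ring
  have hprob : ∀ x : Fin N → ℝ, l2norm x = 1 →
      μ.real {ω | filteredEnergy V ((Φ ω).mulVec x) ≤ n / 4} ≤ Real.exp (-(γ * n)) ∧
      μ.real {ω | 12 * c * n ≤ filteredEnergy V ((Φ ω).mulVec x)} ≤ Real.exp (-(γ * n)) := by
    intro x hx
    have hx2 : ∑ j, x j ^ 2 = 1 := by rw [← l2norm_sq, hx, one_pow]
    have h := measureReal_avg_sum_sq (X := fun (q : Fin m × Fin N) ω => Φ ω q.1 q.2)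
      (fun q => hmeas _ _) hind hc (fun q => hsub _ _) (fun q => hmean _ _) (fun q => hvar _ _)
      (n := n) hw
      (fun a i q => V a i q.1 * x q.2)
      (fun a i => by
        simp_rw [mul_pow, Fintype.sum_prod_type, ← Finset.mul_sum, hx2, mul_one]
        exact hV1 a i)
      (fun a i j hij q => by
        rw [mul_mul_mul_comm, hV2 a i j hij, zero_mul])
    simp_rw [← hlin] at h
    have hn0 : (0 : ℝ) ≤ n := Nat.cast_nonneg n
    refine ⟨h.1.trans (Real.exp_le_exp.2 ?_), h.2.trans (Real.exp_le_exp.2 ?_)⟩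
    · have : γ * n ≤ 1 / (768 * c ^ 2) * n := by gcongr; exact min_le_right _ _
      rw [one_div_mul_eq_div] at this
      linarith
    · have : γ * n ≤ 1 * n := by gcongr; exact min_le_left _ _
      linarith
  have hsqn : √(n : ℝ) ^ 2 = n := Real.sq_sqrt (Nat.cast_nonneg n)
  have hsqc : √(12 * (c : ℝ)) ^ 2 = 12 * c := Real.sq_sqrt (by positivity)
  obtain ⟨E, hE1, hE2, hE3⟩ := exists_event_sparse_bounds (μ := μ) (Ψ := Ψ)
    (a := √n / 2) (b := √(12 * c) * √n) (ε := ε) (p := Real.exp (-(γ * n)))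
    (fun q j => by
      simp only [Ψ, Matrix.of_apply]
      refine Measurable.const_mul (Finset.measurable_fun_sum _ fun p _ => ?_) _
      exact (hmeas p j).const_mul _)
    (by positivity) (Real.exp_pos _).le hε0 (min_le_left _ _)
    (by
      have h1 : ε ≤ 1 / (8 * √(12 * c)) := min_le_right _ _
      calc 4 * (√(12 * c) * √n) * ε ≤ 4 * (√(12 * c) * √n) * (1 / (8 * √(12 * c))) := by gcongr
        _ = √n / 2 := by field_simp; ring)
    (fun x hx => by
      refine le_trans (measureReal_mono fun ω hω => ?_) (hprob x hx).1
      simp only [Set.mem_ofPred_eq] at hω ⊢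
      rw [← hΨ]
      calc _ ≤ (√n / 2) ^ 2 := by gcongr; exact l2norm_nonneg _
        _ = n / 4 := by rw [div_pow, hsqn]; norm_num)
    (fun x hx => by
      refine le_trans (measureReal_mono fun ω hω => ?_) (hprob x hx).2
      simp only [Set.mem_ofPred_eq] at hω ⊢
      rw [← hΨ]
      calc 12 * c * n = (√(12 * c) * √n) ^ 2 := by rw [mul_pow, hsqn, hsqc]
        _ ≤ _ := by gcongr)
    hsN
  refine ⟨E, hE1, hE2.trans ?_, fun ω hω x hx => ?_⟩
  · have hs' : (1 : ℝ) ≤ s := by exact_mod_cast hs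
    have ht := one_le_log_exp_mul_div hs hsN
    have hN : (0 : ℝ) < N := by exact_mod_cast hs.trans hsN
    refine le_trans ?_ (union_bound_numerics hγ hK ht hs' hn)
    have e1 : (1 + 2 / ε) ^ s = Real.exp (s * Real.log (1 + 2 / ε)) := by
      rw [Real.exp_nat_mul, Real.exp_log (by linarith)]
    have e2 : (N.choose s : ℝ) ≤ Real.exp (s * Real.log (Real.exp 1 * N / s)) := by
      rw [Real.exp_nat_mul, Real.exp_log (by positivity)]
      exact choose_le_exp_pow hs
    rw [e1]
    gcongr
  · obtain ⟨h1, h2⟩ := hE3 ω hω x hx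
    have hx0 := l2norm_nonneg x
    rw [← hΨ]
    constructor
    · calc n / 16 * l2norm x ^ 2 = (√n / 2 / 2 * l2norm x) ^ 2 := by
            rw [mul_pow, div_pow, div_pow, hsqn]; ring
        _ ≤ _ := by gcongr
    · calc _ ≤ (2 * (√(12 * c) * √n) * l2norm x) ^ 2 := by gcongr; exact l2norm_nonneg _
        _ = 48 * c * n * l2norm x ^ 2 := by
            rw [mul_pow, mul_pow, mul_pow, hsqn, hsqc]; ring

end Filtered

/-! ### The difference matrix and power series -/

section Difference

open PowerSeries

/-- The generating series of a finite sequence. -/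
noncomputable def toSeries {m : ℕ} (z : Fin m → ℝ) : PowerSeries ℝ :=
  PowerSeries.mk fun i => if h : i < m then z ⟨i, h⟩ else 0

lemma coeff_toSeries {m : ℕ} (z : Fin m → ℝ) (i : Fin m) : coeff (i : ℕ) (toSeries z) = z i := by
  simp [toSeries]

lemma diffMatrix_mulVec {m : ℕ} (z : Fin m → ℝ) (i : Fin m) :
    (diffMatrix m).mulVec z i
      = coeff (i : ℕ) (toSeries z) - coeff (i : ℕ) (X * toSeries z) := by
  have e : ∀ j, diffMatrix m i j * z j
      = (if j = i then z j else 0) - (if (i : ℕ) = (j : ℕ) + 1 then z j else 0) := by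
    intro j
    simp only [diffMatrix, Matrix.of_apply]
    by_cases h1 : i = j
    · subst h1; simp
    · have h1' : ¬ j = i := fun h => h1 h.symm
      by_cases h2 : (i : ℕ) = (j : ℕ) + 1 <;> simp [h1, h1', h2]
  simp only [Matrix.mulVec, dotProduct]
  simp_rw [e]
  rw [Finset.sum_sub_distrib, coeff_toSeries, Finset.sum_ite_eq' Finset.univ i]
  simp only [Finset.mem_univ, if_true]
  congr 1
  obtain ⟨i, hi⟩ := i
  cases i with
  | zero => simp
  | succ i =>
    have hi' : i < m := by omega
    simp only [coeff_succ_X_mul]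
    have hc : coeff i (toSeries z) = z ⟨i, hi'⟩ := coeff_toSeries z ⟨i, hi'⟩
    rw [hc, ← Finset.sum_filter, Finset.sum_eq_single_of_mem ⟨i, hi'⟩ (by simp)]
    intro j hj hne
    exfalso; apply hne; ext
    simpa using (Finset.mem_filter.1 hj).2.symm

/-- The difference matrix acts as multiplication by `1 - X`, modulo `X ^ m`. -/
lemma X_pow_dvd_toSeries_diffMatrix_pow (m r : ℕ) (z : Fin m → ℝ) :
    (X : PowerSeries ℝ) ^ m ∣ toSeries ((diffMatrix m ^ r).mulVec z) - (1 - X) ^ r * toSeries z := by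
  induction r with
  | zero => simp
  | succ r ih =>
    have h1 : ∀ y : Fin m → ℝ, (X : PowerSeries ℝ) ^ m ∣
        toSeries ((diffMatrix m).mulVec y) - (1 - X) * toSeries y := by
      intro y
      rw [X_pow_dvd_iff]
      intro i hi
      have := diffMatrix_mulVec y ⟨i, hi⟩
      rw [← coeff_toSeries ((diffMatrix m).mulVec y)] at this
      simp only at this
      rw [map_sub, this, sub_mul, one_mul, map_sub, sub_self]
    have h2 := dvd_add (h1 ((diffMatrix m ^ r).mulVec z)) (Dvd.dvd.mul_left ih (1 - X))
    rw [Matrix.mulVec_mulVec, ← pow_succ'] at h2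
    convert h2 using 1
    ring

/-- Energy of the first `m` coefficients of a power series. -/
noncomputable def energy (m : ℕ) (f : PowerSeries ℝ) : ℝ := ∑ p ∈ Finset.range m, coeff p f ^ 2

lemma energy_toSeries {m : ℕ} (z : Fin m → ℝ) : energy m (toSeries z) = l2norm z ^ 2 := by
  rw [l2norm_sq, energy, Finset.sum_range]
  simp_rw [coeff_toSeries]

lemma energy_congr {m : ℕ} {f g : PowerSeries ℝ} (h : X ^ m ∣ f - g) : energy m f = energy m g := by
  rw [X_pow_dvd_iff] at h
  refine Finset.sum_congr rfl fun p hp => ?_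
  have := h p (Finset.mem_range.1 hp)
  rw [map_sub, sub_eq_zero] at this
  rw [this]

lemma energy_X_pow_mul_le (m h : ℕ) (f : PowerSeries ℝ) : energy m (X ^ h * f) ≤ energy m f := by
  simp only [energy, coeff_X_pow_mul']
  rw [← Finset.sum_filter_add_sum_filter_not (Finset.range m) (fun p => h ≤ p)]
  have h0 : ∑ p ∈ Finset.range m with ¬ h ≤ p, (if h ≤ p then coeff (p - h) f else 0) ^ 2 = 0 :=
    Finset.sum_eq_zero fun p hp => by rw [if_neg (Finset.mem_filter.1 hp).2]; norm_num
  rw [h0, add_zero]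
  have h1 : ∑ p ∈ Finset.range m with h ≤ p, (if h ≤ p then coeff (p - h) f else 0) ^ 2
      = ∑ p ∈ (Finset.range m).filter (fun p => h ≤ p), coeff (p - h) f ^ 2 :=
    Finset.sum_congr rfl fun p hp => by rw [if_pos (Finset.mem_filter.1 hp).2]
  have hinj : Set.InjOn (fun p => p - h)
      ((Finset.range m).filter (fun p => h ≤ p) : Finset ℕ) := by
    intro p hp q hq hpq
    simp only [Finset.coe_filter, Set.mem_ofPred_eq] at hp hq hpq
    omega
  rw [h1, ← Finset.sum_image (f := fun q => coeff q f ^ 2) hinj]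
  refine Finset.sum_le_sum_of_subset_of_nonneg ?_ fun _ _ _ => sq_nonneg _
  intro q hq
  obtain ⟨p, hp, rfl⟩ := Finset.mem_image.1 hq
  simp only [Finset.mem_filter, Finset.mem_range] at hp ⊢
  omega

/-- A coarse difference of step `h` at most quadruples the energy. -/
lemma energy_one_sub_X_pow_pow_mul_le (m h r : ℕ) (f : PowerSeries ℝ) :
    energy m ((1 - X ^ h) ^ r * f) ≤ 4 ^ r * energy m f := by
  induction r with
  | zero => simp
  | succ r ih =>
    have h1 : ∀ g : PowerSeries ℝ, energy m ((1 - X ^ h) * g) ≤ 4 * energy m g := by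
      intro g
      have : energy m ((1 - X ^ h) * g) ≤ 2 * energy m g + 2 * energy m (X ^ h * g) := by
        simp only [energy, Finset.mul_sum, ← Finset.sum_add_distrib, sub_mul, one_mul, map_sub]
        refine Finset.sum_le_sum fun p _ => ?_
        nlinarith [sq_nonneg (coeff p g + coeff p (X ^ h * g))]
      linarith [energy_X_pow_mul_le m h g]
    rw [pow_succ', mul_assoc, pow_succ']
    refine (h1 _).trans ?_
    linarith

/-- The coefficients of the `r`-fold convolution of a block of `h` ones: a discrete B-spline. -/
noncomputable def spline (r h : ℕ) : Polynomial ℝ := (∑ i ∈ Finset.range h, Polynomial.X ^ i) ^ r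

lemma spline_mul_one_sub_X_pow (r h : ℕ) :
    ((spline r h : Polynomial ℝ) : PowerSeries ℝ) * (1 - X) ^ r = (1 - X ^ h) ^ r := by
  have : (spline r h : PowerSeries ℝ) = (∑ i ∈ Finset.range h, (X : PowerSeries ℝ) ^ i) ^ r := by
    rw [spline, ← Polynomial.coeToPowerSeries.ringHom_apply, map_pow, map_sum]
    simp [Polynomial.coeToPowerSeries.ringHom_apply]
  rw [this, ← mul_pow, geom_sum_mul_neg]

lemma natDegree_spline_lt {r h : ℕ} (hr : 1 ≤ r) (hh : 1 ≤ h) :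
    (spline r h).natDegree < r * h := by
  have h1 : (∑ i ∈ Finset.range h, (Polynomial.X : Polynomial ℝ) ^ i).natDegree ≤ h - 1 := by
    refine Polynomial.natDegree_sum_le_of_forall_le _ _ fun i hi => ?_
    rw [Polynomial.natDegree_X_pow]
    have := Finset.mem_range.1 hi
    omega
  have h2 : (spline r h).natDegree ≤ r * (h - 1) :=
    Polynomial.natDegree_pow_le_of_le r h1
  refine h2.trans_lt ?_
  exact Nat.mul_lt_mul_of_pos_left (by omega) hr

lemma sum_spline_coeff_sq {r h : ℕ} (hr : 1 ≤ r) (hh : 1 ≤ h) :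
    (h : ℝ) ^ (2 * r) ≤ (r * h : ℕ) * ∑ t ∈ Finset.range (r * h), (spline r h).coeff t ^ 2 := by
  have h1 : (spline r h).eval 1 = (h : ℝ) ^ r := by
    simp [spline, Polynomial.eval_finsetSum]
  rw [Polynomial.eval_eq_sum_range' (natDegree_spline_lt hr hh)] at h1
  simp only [one_pow, mul_one] at h1
  have h2 := sq_sum_le_card_mul_sum_sq (s := Finset.range (r * h))
    (f := fun t => (spline r h).coeff t)
  rw [h1, Finset.card_range, ← pow_mul, mul_comm r 2] at h2
  exact h2

end Difference

/-! ### Spline filters with disjoint windows -/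

section Filters

/-- The top index of the `i`th window of width `w` at offset `a`. -/
def windowTop (w a i : ℕ) : ℕ := w - 1 + a + w * i

/-- Normalized filters with disjoint windows, along which the `r`th difference of a sequence `z`
has energy controlled by that of `z`, with a gain of `h ^ (2 r)`. -/
lemma exists_filters {r h m n : ℕ} (hr : 1 ≤ r) (hh : 1 ≤ h) (hm : r * h * (n + 1) ≤ m) :
    ∃ V : Fin (r * h) → Fin n → Fin m → ℝ, (∀ a i, ∑ p, V a i p ^ 2 = 1) ∧
      (∀ a i j, i ≠ j → ∀ p, V a i p * V a j p = 0) ∧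
      ∀ z : Fin m → ℝ, (h : ℝ) ^ (2 * r) * filteredEnergy V ((diffMatrix m ^ r).mulVec z)
        ≤ 4 ^ r * l2norm z ^ 2 := by
  set w := r * h with hw
  have hw0 : 0 < w := Nat.mul_pos hr hh
  have hw' : (0 : ℝ) < w := by exact_mod_cast hw0
  set β : ℝ := ∑ t ∈ Finset.range w, (spline r h).coeff t ^ 2 with hβ
  have hβ1 : (h : ℝ) ^ (2 * r) ≤ w * β := sum_spline_coeff_sq hr hh
  have hh' : (0 : ℝ) < h := by exact_mod_cast hh
  have hβ0 : 0 < β := by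
    have : 0 < w * β := lt_of_lt_of_le (by positivity) hβ1
    exact pos_of_mul_pos_right this hw'.le
  have hcoeff : ∀ t, w ≤ t → (spline r h).coeff t = 0 := fun t ht =>
    Polynomial.coeff_eq_zero_of_natDegree_lt ((natDegree_spline_lt hr hh).trans_le ht)
  have htop : ∀ (a : Fin w) (i : Fin n), windowTop w a i < m := by
    intro a i
    have h1 : w * (i : ℕ) + w ≤ w * n := by
      rw [← Nat.mul_succ]; exact Nat.mul_le_mul_left w i.2
    have := a.2
    simp only [windowTop]
    rw [Nat.mul_succ] at hm
    omega
  let V : Fin w → Fin n → Fin m → ℝ := fun a i p =>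
    (√β)⁻¹ * if (p : ℕ) ≤ windowTop w a i then (spline r h).coeff (windowTop w a i - p) else 0
  have hsum : ∀ (a : Fin w) (i : Fin n) (g : ℕ → ℝ → ℝ), (∀ p, g p 0 = 0) →
      ∑ p : Fin m, g p (if (p : ℕ) ≤ windowTop w a i
        then (spline r h).coeff (windowTop w a i - p) else 0)
      = ∑ t ∈ Finset.range (windowTop w a i + 1), g (windowTop w a i - t) ((spline r h).coeff t) := by
    intro a i g hg
    rw [← Finset.sum_range (fun p => g p (if p ≤ windowTop w a i
      then (spline r h).coeff (windowTop w a i - p) else 0))]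
    rw [← Finset.sum_subset (Finset.range_mono (htop a i))]
    · rw [← Finset.sum_range_reflect]
      refine Finset.sum_congr rfl fun t ht => ?_
      have := Finset.mem_range.1 ht
      rw [if_pos (by omega)]
      congr 2; omega
    · intro p _ hp
      rw [Finset.mem_range, not_lt] at hp
      rw [if_neg (by omega), hg]
  refine ⟨V, ?_, ?_, ?_⟩
  · intro a i
    simp only [V, mul_pow, inv_pow, Real.sq_sqrt hβ0.le, ← Finset.mul_sum]
    rw [hsum a i (fun _ t => t ^ 2) (by simp)]
    have : ∑ t ∈ Finset.range (windowTop w a i + 1), (spline r h).coeff t ^ 2 = β := by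
      refine (Finset.sum_subset (Finset.range_mono ?_) fun t _ ht => ?_).symm
      · simp only [windowTop]; omega
      · rw [hcoeff t (by simpa using ht)]; norm_num
    rw [this, inv_mul_cancel₀ hβ0.ne']
  · intro a i j hij p
    by_contra hne
    simp only [V, mul_eq_zero, not_or] at hne
    obtain ⟨⟨_, h1⟩, ⟨_, h2⟩⟩ := hne
    have h3 : (p : ℕ) ≤ windowTop w a i := by by_contra hc; rw [if_neg hc] at h1; exact h1 rfl
    have h4 : (p : ℕ) ≤ windowTop w a j := by by_contra hc; rw [if_neg hc] at h2; exact h2 rfl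
    rw [if_pos h3] at h1
    rw [if_pos h4] at h2
    have h5 : windowTop w a i - p < w := by by_contra hc; exact h1 (hcoeff _ (by omega))
    have h6 : windowTop w a j - p < w := by by_contra hc; exact h2 (hcoeff _ (by omega))
    rcases lt_or_gt_of_ne (fun h => hij (Fin.ext h) : (i : ℕ) ≠ j) with hlt | hlt
    · have h7 : w * (i : ℕ) + w ≤ w * j := by rw [← Nat.mul_succ]; exact Nat.mul_le_mul_left w hlt
      simp only [windowTop] at *
      omega
    · have h7 : w * (j : ℕ) + w ≤ w * i := by rw [← Nat.mul_succ]; exact Nat.mul_le_mul_left w hlt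
      simp only [windowTop] at *
      omega
  · intro z
    set y := (diffMatrix m ^ r).mulVec z with hy
    set B : PowerSeries ℝ := ((spline r h : Polynomial ℝ) : PowerSeries ℝ) with hB
    have hrow : ∀ a i, ∑ p, V a i p * y p
        = (√β)⁻¹ * PowerSeries.coeff (windowTop w a i) (B * toSeries y) := by
      intro a i
      simp only [V, mul_assoc, ← Finset.mul_sum]
      congr 1
      have e : ∀ p : Fin m, y p = PowerSeries.coeff (p : ℕ) (toSeries y) := fun p =>
        (coeff_toSeries y p).symm
      simp_rw [e]
      rw [hsum a i (fun p t => t * PowerSeries.coeff p (toSeries y)) (by simp),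
        PowerSeries.coeff_mul, Finset.Nat.sum_antidiagonal_eq_sum_range_succ_mk]
      simp [hB]
    have henergy : energy m (B * toSeries y) ≤ 4 ^ r * l2norm z ^ 2 := by
      rw [← energy_toSeries]
      refine le_trans (le_of_eq ?_) (energy_one_sub_X_pow_pow_mul_le m h r (toSeries z))
      apply energy_congr
      rw [← spline_mul_one_sub_X_pow, mul_assoc, ← mul_sub]
      exact Dvd.dvd.mul_left (X_pow_dvd_toSeries_diffMatrix_pow m r z) _
    have hwin : ∑ a : Fin w, ∑ i : Fin n, PowerSeries.coeff (windowTop w a i) (B * toSeries y) ^ 2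
        ≤ energy m (B * toSeries y) := by
      rw [← Fintype.sum_prod_type'
        (f := fun (a : Fin w) (i : Fin n) => PowerSeries.coeff (windowTop w a i) (B * toSeries y) ^ 2)]
      have hinj : Set.InjOn (fun q : Fin w × Fin n => windowTop w q.1 q.2)
          (Finset.univ : Finset (Fin w × Fin n)) := by
        rintro ⟨a, i⟩ _ ⟨b, j⟩ _ hab
        simp only [windowTop] at hab
        have h1 : (a : ℕ) + w * i = b + w * j := by omega
        have h2 : (i : ℕ) = j := by
          have := congrArg (· / w) h1
          simpa [Nat.add_mul_div_left _ _ hw0, Nat.div_eq_of_lt a.2, Nat.div_eq_of_lt b.2] using this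
        have h3 : (a : ℕ) = b := by rw [h2] at h1; omega
        exact Prod.ext (Fin.ext h3) (Fin.ext h2)
      rw [← Finset.sum_image (f := fun p => PowerSeries.coeff p (B * toSeries y) ^ 2) hinj]
      refine Finset.sum_le_sum_of_subset_of_nonneg ?_ fun _ _ _ => sq_nonneg _
      intro q hq
      obtain ⟨⟨a, i⟩, _, rfl⟩ := Finset.mem_image.1 hq
      exact Finset.mem_range.2 (htop a i)
    simp only [filteredEnergy, hrow, mul_pow, inv_pow, Real.sq_sqrt hβ0.le, ← Finset.mul_sum]
    have h0 : 0 ≤ ∑ a : Fin w, ∑ i : Fin n,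
        PowerSeries.coeff (windowTop w a i) (B * toSeries y) ^ 2 :=
      Finset.sum_nonneg fun _ _ => Finset.sum_nonneg fun _ _ => sq_nonneg _
    calc _ = (h : ℝ) ^ (2 * r) / (w * β) * ∑ a : Fin w, ∑ i : Fin n,
          PowerSeries.coeff (windowTop w a i) (B * toSeries y) ^ 2 := by
            field_simp
      _ ≤ 1 * ∑ a : Fin w, ∑ i : Fin n,
          PowerSeries.coeff (windowTop w a i) (B * toSeries y) ^ 2 := by
            gcongr
            exact (div_le_one (by positivity)).2 hβ1
      _ ≤ _ := by rw [one_mul]; exact hwin.trans henergy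

end Filters

/-! ### The greedy quantizer -/

section Quantizer

open PowerSeries

/-- The power `D ^ r` acts as the `r`th difference on sequences vanishing at negative times. -/
lemma diffMatrix_pow_mulVec {m : ℕ} (r : ℕ) {u : ℤ → ℝ} (hu : ∀ i : ℤ, i < 0 → u i = 0)
    (i : Fin m) :
    (diffMatrix m ^ r).mulVec (fun i : Fin m => u ((i : ℕ) : ℤ)) i
      = ∑ j ∈ Finset.range (r + 1),
          (r.choose j : ℝ) * (-1) ^ j * u (((i : ℕ) : ℤ) - (j : ℤ)) := by
  set z : Fin m → ℝ := fun i => u ((i : ℕ) : ℤ) with hz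
  have h1 := X_pow_dvd_iff.1 (X_pow_dvd_toSeries_diffMatrix_pow m r z) i i.2
  rw [map_sub, coeff_toSeries, sub_eq_zero] at h1
  have h2 : (1 - X : PowerSeries ℝ) ^ r
      = ∑ j ∈ Finset.range (r + 1), C ((r.choose j : ℝ) * (-1) ^ j) * X ^ j := by
    rw [sub_eq_neg_add, add_pow]
    refine Finset.sum_congr rfl fun j _ => ?_
    rw [one_pow, mul_one, neg_pow, map_mul, map_pow, map_neg, map_one, map_natCast]
    ring
  rw [h1, h2, Finset.sum_mul, map_sum]
  refine Finset.sum_congr rfl fun j _ => ?_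
  rw [mul_assoc, coeff_C_mul, coeff_X_pow_mul']
  congr 1
  split_ifs with hji
  · have hlt : (i : ℕ) - j < m := by omega
    have : coeff ((i : ℕ) - j) (toSeries z) = z ⟨(i : ℕ) - j, hlt⟩ := coeff_toSeries z ⟨_, hlt⟩
    rw [this, hz]
    simp only
    congr 1
    omega
  · exact (hu _ (by omega)).symm

lemma abs_sub_mul_round_le {Δ : ℝ} (hΔ : 0 < Δ) (t : ℝ) : |t - Δ * round (t / Δ)| ≤ Δ / 2 := by
  have h := abs_sub_round (t / Δ)
  have e : t - Δ * round (t / Δ) = Δ * (t / Δ - round (t / Δ)) := by field_simp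
  rw [e, abs_mul, abs_of_pos hΔ]
  calc _ ≤ Δ * (1 / 2) := by gcongr
    _ = _ := by ring

lemma abs_sub_mul_round_le_abs {Δ : ℝ} (hΔ : 0 < Δ) (t : ℝ) (n : ℤ) :
    |t - Δ * round (t / Δ)| ≤ |t - Δ * n| := by
  have e : ∀ n : ℤ, |t - Δ * n| = Δ * |t / Δ - n| := by
    intro n
    rw [← abs_of_pos hΔ, ← abs_mul, abs_of_pos hΔ]
    congr 1; field_simp
  rw [e, e]
  exact mul_le_mul_of_nonneg_left (round_le (t / Δ) n) hΔ.le

/-- The greedy quantizer is stable: the state stays bounded by half the step size. -/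
lemma IsQuantization.exists_state {m r : ℕ} {Δ : ℝ} (hΔ : 0 < Δ) {y q : Fin m → ℝ}
    (h : IsQuantization r Δ y q) :
    ∃ z : Fin m → ℝ, (diffMatrix m ^ r).mulVec z = y - q ∧ ∀ i, |z i| ≤ Δ / 2 := by
  obtain ⟨u, hu, h⟩ := h
  refine ⟨fun i => u ((i : ℕ) : ℤ), ?_, fun i => ?_⟩
  · ext i
    rw [diffMatrix_pow_mulVec r hu, (h i).2.1, Pi.sub_apply]
  · exact ((h i).2.2 (round ((u ((i : ℕ) : ℤ) + q i) / Δ))).trans (abs_sub_mul_round_le hΔ _)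

/-- The input of the rounding step: the value that the state would take if the quantizer output `0`
at this time. -/
noncomputable def greedyPreState (r : ℕ) (y : ℕ → ℝ) (i : ℕ) (past : (j : ℕ) → j < i → ℝ) : ℝ :=
  y i - ∑ j ∈ Finset.range r, (r.choose (j + 1) : ℝ) * (-1) ^ (j + 1) *
    if h : j + 1 ≤ i then past (i - (j + 1)) (by omega) else 0

/-- The state sequence of the greedy quantizer with ties broken by `round`. -/
noncomputable def greedyState (r : ℕ) (Δ : ℝ) (y : ℕ → ℝ) : ℕ → ℝ := fun i =>
  Nat.strongRec (fun i past =>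
    greedyPreState r y i past - Δ * round (greedyPreState r y i past / Δ)) i

lemma greedyState_eq (r : ℕ) (Δ : ℝ) (y : ℕ → ℝ) (i : ℕ) :
    greedyState r Δ y i
      = greedyPreState r y i (fun j _ => greedyState r Δ y j)
        - Δ * round (greedyPreState r y i (fun j _ => greedyState r Δ y j) / Δ) := by
  unfold greedyState
  rw [Nat.strongRec_eq]

lemma exists_isQuantization {m r : ℕ} {Δ : ℝ} (hΔ : 0 < Δ) (y : Fin m → ℝ) :
    ∃ q, IsQuantization r Δ y q := by
  let Y : ℕ → ℝ := fun i => if h : i < m then y ⟨i, h⟩ else 0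
  let g := greedyState r Δ Y
  let P : ℕ → ℝ := fun i => greedyPreState r Y i (fun j _ => greedyState r Δ Y j)
  let u : ℤ → ℝ := fun i => if 0 ≤ i then g i.toNat else 0
  have hu : ∀ i : ℕ, u (i : ℤ) = P i - Δ * round (P i / Δ) := by
    intro i
    simp only [u, Nat.cast_nonneg, if_true, Int.toNat_natCast]
    exact greedyState_eq r Δ Y i
  refine ⟨fun i => Δ * round (P i / Δ), u, fun i hi => if_neg (not_le.2 hi), fun i =>
    ⟨⟨_, rfl⟩, ?_, fun n => ?_⟩⟩
  · rw [Finset.sum_range_succ']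
    have hP : P i = y i - ∑ j ∈ Finset.range r, (r.choose (j + 1) : ℝ) * (-1) ^ (j + 1) *
        u (((i : ℕ) : ℤ) - ((j + 1 : ℕ) : ℤ)) := by
      simp only [P, greedyPreState, Y, i.2, dif_pos]
      congr 1
      refine Finset.sum_congr rfl fun j _ => ?_
      congr 1
      by_cases h : j + 1 ≤ (i : ℕ)
      · have h' : (0 : ℤ) ≤ ((i : ℕ) : ℤ) - ((j + 1 : ℕ) : ℤ) := by omega
        rw [dif_pos h]
        simp only [u, if_pos h', g]
        congr 1; omega
      · have h' : ¬ (0 : ℤ) ≤ ((i : ℕ) : ℤ) - ((j + 1 : ℕ) : ℤ) := by omega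
        rw [dif_neg h]
        simp only [u, if_neg h']
    have h0 := hu i
    simp only [Nat.choose_zero_right, Nat.cast_one, pow_zero, mul_one, one_mul, Nat.cast_zero,
      sub_zero]
    rw [h0]
    linarith
  · rw [hu, sub_add_cancel]
    exact abs_sub_mul_round_le_abs hΔ _ n

end Quantizer

/-! ### Sobolev duals -/

section SobolevDual

variable {ι κ : Type*} [Fintype ι] [Fintype κ] [DecidableEq κ]

open scoped Matrix.Norms.L2Operator in
lemma l2opNorm_nonneg (A : Matrix ι κ ℝ) : 0 ≤ l2opNorm A := norm_nonneg A

open scoped Matrix.Norms.L2Operator in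
lemma l2norm_mulVec_le (A : Matrix ι κ ℝ) (v : κ → ℝ) :
    l2norm (A.mulVec v) ≤ l2opNorm A * l2norm v :=
  Matrix.l2_opNorm_mulVec A (WithLp.toLp 2 v)

open scoped Matrix.Norms.L2Operator in
lemma l2opNorm_le {A : Matrix ι κ ℝ} {t : ℝ} (ht : 0 ≤ t)
    (h : ∀ v, l2norm (A.mulVec v) ≤ t * l2norm v) : l2opNorm A ≤ t := by
  rw [l2opNorm, Matrix.l2_opNorm_def]
  exact ContinuousLinearMap.opNorm_le_bound _ ht fun v => h v.ofLp

lemma l2norm_mul_self (v : ι → ℝ) : dotProduct v v = l2norm v ^ 2 := by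
  rw [l2norm_sq]; exact Finset.sum_congr rfl fun _ _ => (sq _).symm

lemma dotProduct_le_l2norm (v w : ι → ℝ) : dotProduct v w ≤ l2norm v * l2norm w := by
  have := real_inner_le_norm (WithLp.toLp 2 w) (WithLp.toLp 2 v)
  rw [mul_comm]
  simpa [l2norm, PiLp.inner_apply, dotProduct] using this

/-- If `‖x‖ ≤ σ⁻¹ ‖P⁻¹ A x‖`, then the pseudoinverse `G` of `H = P⁻¹ A` yields a left inverse
`G P⁻¹` of `A` minimizing the operator norm of `M P`, and the minimum is at most `σ⁻¹`. -/
lemma exists_minimal_left_inverse [DecidableEq ι] {P Q : Matrix ι ι ℝ} (hPQ : P * Q = 1) (hQP : Q * P = 1)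
    (A : Matrix ι κ ℝ) {σ : ℝ} (hσ : 0 < σ)
    (h : ∀ x z, P.mulVec z = A.mulVec x → σ * l2norm x ≤ l2norm z) :
    ∃ M : Matrix κ ι ℝ, M * A = 1 ∧ l2opNorm (M * P) ≤ σ⁻¹ ∧
      ∀ M' : Matrix κ ι ℝ, M' * A = 1 → l2opNorm (M * P) ≤ l2opNorm (M' * P) := by
  set H := Q * A with hH
  have hHσ : ∀ x, σ * l2norm x ≤ l2norm (H.mulVec x) := fun x => h x _ (by
    rw [hH, Matrix.mulVec_mulVec, ← Matrix.mul_assoc, hPQ, Matrix.one_mul])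
  have hunit : IsUnit (H.transpose * H) := by
    rw [← Matrix.mulVec_injective_iff_isUnit]
    intro x x' hxx
    have h0 : (H.transpose * H).mulVec (x - x') = 0 := by rw [Matrix.mulVec_sub, hxx, sub_self]
    have h1 : l2norm (H.mulVec (x - x')) ^ 2 = 0 := by
      rw [← l2norm_mul_self, Matrix.dotProduct_mulVec, ← Matrix.mulVec_transpose,
        Matrix.mulVec_mulVec, h0, zero_dotProduct]
    have h2 : l2norm (H.mulVec (x - x')) = 0 := by simpa using h1
    have h3 := hHσ (x - x')
    rw [h2] at h3
    have h4 : l2norm (x - x') = 0 := le_antisymm (by nlinarith) (l2norm_nonneg _)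
    exact sub_eq_zero.1 (congrArg WithLp.ofLp (norm_eq_zero.1 h4))
  set G := (H.transpose * H)⁻¹ * H.transpose with hG
  have hdet := (Matrix.isUnit_iff_isUnit_det _).1 hunit
  have hGH : G * H = 1 := by
    rw [hG, Matrix.mul_assoc, Matrix.nonsing_inv_mul _ hdet]
  have hHG : ∀ v, H.transpose.mulVec (H.mulVec (G.mulVec v)) = H.transpose.mulVec v := by
    intro v
    rw [Matrix.mulVec_mulVec, Matrix.mulVec_mulVec, hG, ← Matrix.mul_assoc,
      Matrix.mul_nonsing_inv _ hdet, Matrix.one_mul]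
  have hproj : ∀ v, l2norm (H.mulVec (G.mulVec v)) ≤ l2norm v := by
    intro v
    have h1 : l2norm (H.mulVec (G.mulVec v)) ^ 2 ≤ l2norm (H.mulVec (G.mulVec v)) * l2norm v := by
      calc _ = dotProduct (H.mulVec (G.mulVec v)) (H.mulVec (G.mulVec v)) :=
            (l2norm_mul_self _).symm
        _ = dotProduct (H.transpose.mulVec (H.mulVec (G.mulVec v))) (G.mulVec v) := by
            rw [Matrix.dotProduct_mulVec, ← Matrix.mulVec_transpose]
        _ = dotProduct v (H.mulVec (G.mulVec v)) := by
            rw [hHG, Matrix.dotProduct_mulVec v, ← Matrix.mulVec_transpose]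
        _ ≤ _ := by rw [mul_comm]; exact dotProduct_le_l2norm _ _
    rcases (l2norm_nonneg (H.mulVec (G.mulVec v))).eq_or_lt with h0 | h0
    · rw [← h0]; exact l2norm_nonneg _
    · rw [sq] at h1; exact le_of_mul_le_mul_left h1 h0
  have hMP : G * Q * P = G := by rw [Matrix.mul_assoc, hQP, Matrix.mul_one]
  refine ⟨G * Q, by rw [Matrix.mul_assoc]; exact hGH, ?_, fun M' hM' => ?_⟩
  · rw [hMP]
    refine l2opNorm_le (by positivity) fun v => ?_
    rw [inv_mul_eq_div, le_div_iff₀ hσ, mul_comm]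
    exact (hHσ _).trans (hproj v)
  · rw [hMP]
    refine l2opNorm_le (l2opNorm_nonneg _) fun v => ?_
    have h1 : (M' * P) * H = 1 := by
      rw [hH, Matrix.mul_assoc, ← Matrix.mul_assoc P, hPQ, Matrix.one_mul, hM']
    have h2 : G.mulVec v = (M' * P).mulVec (H.mulVec (G.mulVec v)) := by
      rw [Matrix.mulVec_mulVec, h1, Matrix.one_mulVec]
    rw [h2]
    exact (l2norm_mulVec_le _ _).trans
      (mul_le_mul_of_nonneg_left (hproj v) (l2opNorm_nonneg _))

lemma det_diffMatrix (m : ℕ) : (diffMatrix m).det = 1 := by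
  rw [Matrix.det_of_isLowerTriangular]
  · simp [diffMatrix]
  · intro i j hij
    have hij' : (i : ℕ) < j := hij
    have h1 : i ≠ j := by rintro rfl; exact lt_irrefl _ hij'
    have h2 : ¬ ((i : ℕ) = (j : ℕ) + 1) := by omega
    simp [diffMatrix, h1, h2]

lemma exists_isSobolevDual {m r : ℕ} (A : Matrix (Fin m) κ ℝ) {σ : ℝ} (hσ : 0 < σ)
    (h : ∀ x z, (diffMatrix m ^ r).mulVec z = A.mulVec x → σ * l2norm x ≤ l2norm z) :
    (∃ L, IsSobolevDual r A L) ∧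
      ∀ L, IsSobolevDual r A L → l2opNorm (L * diffMatrix m ^ r) ≤ σ⁻¹ := by
  have hdet : IsUnit (diffMatrix m ^ r).det := by
    rw [Matrix.det_pow, det_diffMatrix, one_pow]; exact isUnit_one
  obtain ⟨M, hM1, hM2, hM3⟩ := exists_minimal_left_inverse
    (Matrix.mul_nonsing_inv _ hdet) (Matrix.nonsing_inv_mul _ hdet) A hσ h
  exact ⟨⟨M, hM1, hM3⟩, fun L hL => (hL.2 M hM1).trans hM2⟩

end SobolevDual

/-! ### Support recovery by `ℓ¹` minimization -/

section L1Recovery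

variable {m N : ℕ}

lemma exists_largest_subset (v : Fin N → ℝ) (U : Finset (Fin N)) {s : ℕ} (hs : s ≤ U.card) :
    ∃ T ⊆ U, T.card = s ∧ ∀ i ∈ T, ∀ j ∈ U, j ∉ T → |v j| ≤ |v i| := by
  induction s with
  | zero => exact ⟨∅, by simp, by simp, by simp⟩
  | succ s ih =>
    obtain ⟨T, hTU, hT, hmax⟩ := ih (by omega)
    have hne : (U \ T).Nonempty := by
      rw [← Finset.card_pos, Finset.card_sdiff_of_subset hTU]; omega
    obtain ⟨i, hi, hi2⟩ := Finset.exists_max_image (U \ T) (fun j => |v j|) hne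
    rw [Finset.mem_sdiff] at hi
    refine ⟨insert i T, Finset.insert_subset hi.1 hTU, by
      rw [Finset.card_insert_of_notMem hi.2, hT], fun l hl j hj hjT => ?_⟩
    rw [Finset.mem_insert, not_or] at hjT
    rcases Finset.mem_insert.1 hl with rfl | hl
    · exact hi2 j (Finset.mem_sdiff.2 ⟨hj, hjT.2⟩)
    · exact hmax l hl j hj hjT.2

lemma exists_isLargestIndexSet {k : ℕ} (hk : k ≤ N) (z : Fin N → ℝ) :
    ∃ T, IsLargestIndexSet k z T := by
  obtain ⟨T, _, hT, h⟩ := exists_largest_subset z Finset.univ (s := k) (by simpa using hk)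
  exact ⟨T, hT, fun i hi j hj => h i hi j (Finset.mem_univ j) hj⟩

/-- A set of `s` largest entries (or all of them, if there are fewer) dominates the others. -/
lemma exists_dominating_subset (v : Fin N → ℝ) (U : Finset (Fin N)) (s : ℕ) :
    ∃ T ⊆ U, T.card ≤ s ∧ ∀ j ∈ U, j ∉ T → s * |v j| ≤ ∑ i ∈ T, |v i| := by
  rcases le_or_gt s U.card with hs | hs
  · obtain ⟨T, hTU, hT, hmax⟩ := exists_largest_subset v U hs
    refine ⟨T, hTU, hT.le, fun j hj hjT => ?_⟩
    have := Finset.card_nsmul_le_sum T (fun i => |v i|) |v j| fun i hi => hmax i hi j hj hjT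
    rwa [hT, nsmul_eq_mul] at this
  · exact ⟨U, subset_rfl, hs.le, fun j hj hjU => absurd hj hjU⟩

/-- The vector that agrees with `v` on `T` and vanishes elsewhere. -/
def restrictTo (T : Finset (Fin N)) (v : Fin N → ℝ) : Fin N → ℝ := fun j => if j ∈ T then v j else 0

lemma restrictTo_add_compl (T : Finset (Fin N)) (v : Fin N → ℝ) :
    restrictTo T v + restrictTo Tᶜ v = v := by
  ext j
  by_cases h : j ∈ T <;> simp [restrictTo, h]

lemma isSparse_restrictTo (T : Finset (Fin N)) (v : Fin N → ℝ) {s : ℕ} (hT : T.card ≤ s) :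
    IsSparse s (restrictTo T v) := by
  refine (Finset.card_le_card fun j hj => ?_).trans hT
  by_contra h
  simp [restrictTo, h] at hj

lemma IsSparse.mono {s t : ℕ} (hst : s ≤ t) {x : Fin N → ℝ} (hx : IsSparse s x) : IsSparse t x :=
  le_trans hx hst

lemma sum_abs_restrictTo (T : Finset (Fin N)) (v : Fin N → ℝ) :
    ∑ j, |restrictTo T v j| = ∑ j ∈ T, |v j| := by
  rw [← Finset.sum_filter_add_sum_filter_not Finset.univ (· ∈ T)]
  have h0 : ∑ j with j ∉ T, |restrictTo T v j| = 0 :=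
    Finset.sum_eq_zero fun j hj => by simp [restrictTo, (Finset.mem_filter.1 hj).2]
  rw [h0, add_zero]
  simp only [Finset.filter_univ_mem]
  exact Finset.sum_congr rfl fun j hj => by simp [restrictTo, hj]

lemma sum_abs_le_sqrt_mul_l2norm (T : Finset (Fin N)) (v : Fin N → ℝ) {s : ℕ} (hT : T.card ≤ s) :
    ∑ j ∈ T, |v j| ≤ √(s : ℝ) * l2norm v := by
  refine abs_le_of_sq_le_sq' ?_ (mul_nonneg (Real.sqrt_nonneg _) (l2norm_nonneg _)) |>.2
  rw [mul_pow, Real.sq_sqrt (Nat.cast_nonneg s), l2norm_sq]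
  have h1 := sq_sum_le_card_mul_sum_sq (s := T) (f := fun j => |v j|)
  simp only [sq_abs] at h1
  refine h1.trans ?_
  have h2 : ∑ j ∈ T, v j ^ 2 ≤ ∑ j, v j ^ 2 :=
    Finset.sum_le_sum_of_subset_of_nonneg (Finset.subset_univ T) fun _ _ _ => sq_nonneg _
  have h3 : (T.card : ℝ) ≤ s := by exact_mod_cast hT
  have h4 : 0 ≤ ∑ j ∈ T, v j ^ 2 := Finset.sum_nonneg fun _ _ => sq_nonneg _
  gcongr

/-- If `‖Φ v‖ ≤ B ‖v‖` for `s`-sparse `v`, then cutting a general `v` into blocks of `s` entries of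
decreasing magnitude bounds `‖Φ v‖` by the sup and `ℓ¹` norms of `v`. -/
lemma l2norm_mulVec_le_of_sparse_bound {Φ : Matrix (Fin m) (Fin N) ℝ} {B : ℝ} (hB : 0 ≤ B) {s : ℕ}
    (hs : 1 ≤ s) (hΦ : ∀ v, IsSparse s v → l2norm (Φ.mulVec v) ≤ B * l2norm v)
    (v : Fin N → ℝ) (τ : ℝ) (hτ : ∀ j, |v j| ≤ τ) (hτ0 : 0 ≤ τ) :
    l2norm (Φ.mulVec v) ≤ B * (√s * τ + (∑ j, |v j|) / √s) := by
  have hs0 : (0 : ℝ) < s := by exact_mod_cast hs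
  have hss : √(s : ℝ) * √s = s := Real.mul_self_sqrt hs0.le
  have hsq : 0 < √(s : ℝ) := Real.sqrt_pos.2 hs0
  induction hn : (Finset.univ.filter fun j => v j ≠ 0).card using Nat.strong_induction_on
    generalizing v τ with
  | _ n ih =>
    set U := Finset.univ.filter fun j => v j ≠ 0 with hU
    -- a vector with at most `s` entries bounded by `τ`
    have hsmall : ∀ w : Fin N → ℝ, IsSparse s w → (∀ j, |w j| ≤ τ) →
        l2norm (Φ.mulVec w) ≤ B * (√s * τ) := by
      intro w hw hwτ
      refine (hΦ w hw).trans (mul_le_mul_of_nonneg_left ?_ hB)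
      refine l2norm_le_of_sq_le (by positivity) ?_
      rw [mul_pow, Real.sq_sqrt hs0.le]
      have h1 : ∑ j, w j ^ 2 = ∑ j with w j ≠ 0, w j ^ 2 := by
        rw [Finset.sum_filter]
        refine Finset.sum_congr rfl fun j _ => ?_
        by_cases h : w j = 0 <;> simp [h]
      rw [h1]
      refine (Finset.sum_le_card_nsmul _ _ (τ ^ 2) fun j _ => ?_).trans ?_
      · exact sq_le_sq' (by linarith [neg_abs_le (w j), hwτ j]) ((le_abs_self _).trans (hwτ j))
      · rw [nsmul_eq_mul]
        have : (((Finset.univ.filter fun j => w j ≠ 0).card : ℕ) : ℝ) ≤ s := by exact_mod_cast hw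
        gcongr
    rcases le_or_gt U.card s with hle | hgt
    · refine (hsmall v hle hτ).trans (mul_le_mul_of_nonneg_left ?_ hB)
      have : 0 ≤ (∑ j, |v j|) / √s :=
        div_nonneg (Finset.sum_nonneg fun _ _ => abs_nonneg _) hsq.le
      linarith
    · obtain ⟨T, hTU, hT, hmax⟩ := exists_largest_subset v U hgt.le
      set w := restrictTo Tᶜ v with hw
      have hsub : (Finset.univ.filter fun j => w j ≠ 0) ⊆ U \ T := by
        intro j hj
        have hj' : w j ≠ 0 := (Finset.mem_filter.1 hj).2
        have hjT : j ∉ T := fun h => hj' (by simp [hw, restrictTo, h])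
        refine Finset.mem_sdiff.2 ⟨Finset.mem_filter.2 ⟨Finset.mem_univ j, ?_⟩, hjT⟩
        simpa [hw, restrictTo, hjT] using hj'
      have hcard : (Finset.univ.filter fun j => w j ≠ 0).card < n := by
        refine (Finset.card_le_card hsub).trans_lt ?_
        rw [Finset.card_sdiff_of_subset hTU]; omega
      have hτ' : ∀ j, |w j| ≤ (∑ i ∈ T, |v i|) / s := by
        intro j
        rw [le_div_iff₀ hs0, mul_comm]
        by_cases hj : w j = 0
        · rw [hj, abs_zero, mul_zero]; exact Finset.sum_nonneg fun _ _ => abs_nonneg _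
        · have hj2 := Finset.mem_sdiff.1 (hsub (Finset.mem_filter.2 ⟨Finset.mem_univ j, hj⟩))
          have := Finset.card_nsmul_le_sum T (fun i => |v i|) |v j| fun i hi =>
            hmax i hi j hj2.1 hj2.2
          rw [hT, nsmul_eq_mul] at this
          simpa [hw, restrictTo, hj2.2] using this
      have h1 := ih _ hcard w _ hτ'
        (div_nonneg (Finset.sum_nonneg fun _ _ => abs_nonneg _) hs0.le) rfl
      have h2 := hsmall (restrictTo T v) (isSparse_restrictTo T v hT.le) fun j => by
        by_cases h : j ∈ T <;> simp [restrictTo, h, hτ j, hτ0]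
      have h3 : ∑ j, |v j| = ∑ j ∈ T, |v j| + ∑ j, |w j| := by
        rw [hw, sum_abs_restrictTo, Finset.sum_add_sum_compl]
      calc l2norm (Φ.mulVec v) = l2norm (Φ.mulVec (restrictTo T v) + Φ.mulVec w) := by
            rw [← Matrix.mulVec_add, hw, restrictTo_add_compl]
        _ ≤ _ := l2norm_add_le _ _
        _ ≤ B * (√s * τ) + B * (√s * ((∑ i ∈ T, |v i|) / s) + (∑ j, |w j|) / √s) :=
            add_le_add h2 h1
        _ = _ := by
            rw [h3]
            nth_rewrite 3 [← hss]
            field_simp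

/-- Vectors in the `ℓ¹` cone over a small set `S` are controlled by their image under a matrix
that is well conditioned on sparse vectors. -/
lemma abs_le_of_cone {Φ : Matrix (Fin m) (Fin N) ℝ} {a B η : ℝ} (ha : 0 < a) (hB : 0 ≤ B) {k s : ℕ}
    (hs : 1 ≤ s) (hks : 4 * B ^ 2 * k ≤ a ^ 2 * s)
    (hlow : ∀ v, IsSparse (k + s) v → a * l2norm v ≤ l2norm (Φ.mulVec v))
    (hupp : ∀ v, IsSparse (k + s) v → l2norm (Φ.mulVec v) ≤ B * l2norm v)
    {v : Fin N → ℝ} {S : Finset (Fin N)} (hS : S.card ≤ k)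
    (hcone : ∑ j ∈ Sᶜ, |v j| ≤ ∑ j ∈ S, |v j|) (hη : l2norm (Φ.mulVec v) ≤ η) (j : Fin N) :
    |v j| ≤ 2 * η / a := by
  have hs0 : (0 : ℝ) < s := by exact_mod_cast hs
  have hsq : 0 < √(s : ℝ) := Real.sqrt_pos.2 hs0
  obtain ⟨T, hTU, hT, hdom⟩ := exists_dominating_subset v Sᶜ s
  set v₀ := restrictTo (S ∪ T) v with hv₀
  set w := restrictTo (S ∪ T)ᶜ v with hw
  have hv₀0 := l2norm_nonneg v₀
  have hcompl : (S ∪ T)ᶜ = Sᶜ \ T := by ext; simp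
  have hsumT : ∑ i ∈ T, |v i| = ∑ i ∈ T, |v₀ i| := Finset.sum_congr rfl fun i hi => by
    simp [hv₀, restrictTo, hi]
  have hsumS : ∑ i ∈ S, |v i| = ∑ i ∈ S, |v₀ i| := Finset.sum_congr rfl fun i hi => by
    simp [hv₀, restrictTo, hi]
  have hT0 : 0 ≤ (∑ i ∈ T, |v i|) / s :=
    div_nonneg (Finset.sum_nonneg fun _ _ => abs_nonneg _) hs0.le
  have hwj : ∀ j, |w j| ≤ (∑ i ∈ T, |v i|) / s := by
    intro j
    by_cases h : j ∈ S ∪ T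
    · have h1 : w j = 0 := by rw [hw, restrictTo, if_neg fun h2 => Finset.mem_compl.1 h2 h]
      rw [h1, abs_zero]
      exact hT0
    · rw [le_div_iff₀ hs0, mul_comm]
      have h' := Finset.mem_compl.2 h
      rw [hcompl, Finset.mem_sdiff] at h'
      have h1 : w j = v j := by
        rw [hw, restrictTo, if_pos (Finset.mem_compl.2 h)]
      rw [h1]
      exact hdom j h'.1 h'.2
  have hΦw : l2norm (Φ.mulVec w) ≤ a / 2 * l2norm v₀ := by
    have h1 := l2norm_mulVec_le_of_sparse_bound hB hs
      (fun u hu => hupp u (hu.mono (Nat.le_add_left s k))) w _ hwj hT0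
    have h2 : ∑ j ∈ T, |v j| + ∑ j, |w j| = ∑ j ∈ Sᶜ, |v j| := by
      rw [hw, sum_abs_restrictTo, hcompl, add_comm, Finset.sum_sdiff hTU]
    have h3 : √(s : ℝ) * ((∑ i ∈ T, |v i|) / s) + (∑ j, |w j|) / √s = (∑ j ∈ Sᶜ, |v j|) / √s := by
      rw [← h2]
      nth_rewrite 2 [← Real.mul_self_sqrt hs0.le]
      field_simp
    have h4 : ∑ j ∈ Sᶜ, |v j| ≤ √(k : ℝ) * l2norm v₀ := by
      rw [hsumS] at hcone
      exact hcone.trans (sum_abs_le_sqrt_mul_l2norm S v₀ hS)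
    have h5 : B * √(k : ℝ) ≤ a / 2 * √s := by
      refine abs_le_of_sq_le_sq' ?_ (by positivity) |>.2
      rw [mul_pow, mul_pow, Real.sq_sqrt (Nat.cast_nonneg k), Real.sq_sqrt hs0.le]
      linarith
    rw [h3] at h1
    refine h1.trans ?_
    rw [← mul_div_assoc, div_le_iff₀ hsq]
    calc B * ∑ j ∈ Sᶜ, |v j| ≤ B * (√(k : ℝ) * l2norm v₀) := by gcongr
      _ = B * √(k : ℝ) * l2norm v₀ := by ring
      _ ≤ a / 2 * √s * l2norm v₀ := by gcongr
      _ = _ := by ring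
  have hmain : l2norm v₀ ≤ 2 * η / a := by
    have h1 := hlow v₀ (isSparse_restrictTo _ v ((Finset.card_union_le S T).trans (by omega)))
    have h2 : l2norm (Φ.mulVec v₀) ≤ l2norm (Φ.mulVec v) + l2norm (Φ.mulVec w) := by
      have : Φ.mulVec v₀ = Φ.mulVec v - Φ.mulVec w := by
        rw [← Matrix.mulVec_sub, hw]
        nth_rewrite 1 [← restrictTo_add_compl (S ∪ T) v]
        rw [add_sub_cancel_right]
      rw [this]
      exact l2norm_sub_le _ _
    rw [le_div_iff₀ ha]
    linarith
  by_cases h : j ∈ S ∪ T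
  · have : v j = v₀ j := by simp only [hv₀, restrictTo, if_pos h]
    rw [this]
    exact (abs_le_l2norm v₀ j).trans hmain
  · have h1 : w j = v j := by rw [hw, restrictTo, if_pos (Finset.mem_compl.2 h)]
    rw [← h1]
    refine (hwj j).trans (le_trans ?_ hmain)
    rw [hsumT, div_le_iff₀ hs0, mul_comm]
    refine (Finset.sum_le_card_nsmul _ _ _ fun i _ => abs_le_l2norm v₀ i).trans ?_
    rw [nsmul_eq_mul]
    have : (T.card : ℝ) ≤ s := by exact_mod_cast hT
    gcongr

lemma exists_isL1Minimizer (Φ : Matrix (Fin m) (Fin N) ℝ) (q : Fin m → ℝ) (ε : ℝ) {x : Fin N → ℝ}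
    (hx : l2norm (Φ.mulVec x - q) ≤ ε) : ∃ z, IsL1Minimizer Φ q ε z := by
  let f : (Fin N → ℝ) → ℝ := fun w => ∑ j, |w j|
  have hf : Continuous f := by fun_prop
  have hg : Continuous fun w : Fin N → ℝ => l2norm (Φ.mulVec w - q) := by
    unfold l2norm
    fun_prop
  let K : Set (Fin N → ℝ) := {w | l2norm (Φ.mulVec w - q) ≤ ε ∧ f w ≤ f x}
  have hK : IsCompact K := by
    refine Metric.isCompact_of_isClosed_isBounded
      ((isClosed_le hg continuous_const).inter (isClosed_le hf continuous_const)) ?_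
    refine (Metric.isBounded_closedBall (x := (0 : Fin N → ℝ)) (r := f x)).subset fun w hw => ?_
    rw [mem_closedBall_zero_iff, pi_norm_le_iff_of_nonneg (Finset.sum_nonneg fun _ _ => abs_nonneg _)]
    intro j
    refine le_trans ?_ hw.2
    exact Finset.single_le_sum (f := fun j => |w j|) (fun _ _ => abs_nonneg _) (Finset.mem_univ j)
  obtain ⟨z, hzK, hz⟩ := hK.exists_isMinOn ⟨x, hx, le_rfl⟩ hf.continuousOn
  refine ⟨z, hzK.1, fun w hw => ?_⟩
  rcases le_total (f w) (f x) with h | h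
  · exact hz ⟨hw, h⟩
  · exact hzK.2.trans h

/-- The robust null space argument: an `ℓ¹` minimizer is close to a sparse feasible vector. -/
lemma IsL1Minimizer.abs_sub_le {Φ : Matrix (Fin m) (Fin N) ℝ} {a B ε : ℝ} (ha : 0 < a) (hB : 0 ≤ B)
    {k s : ℕ} (hs : 1 ≤ s) (hks : 4 * B ^ 2 * k ≤ a ^ 2 * s)
    (hlow : ∀ v, IsSparse (k + s) v → a * l2norm v ≤ l2norm (Φ.mulVec v))
    (hupp : ∀ v, IsSparse (k + s) v → l2norm (Φ.mulVec v) ≤ B * l2norm v)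
    {x z : Fin N → ℝ} {q : Fin m → ℝ} (hx : IsSparse k x) (hxq : l2norm (Φ.mulVec x - q) ≤ ε)
    (hz : IsL1Minimizer Φ q ε z) (j : Fin N) : |z j - x j| ≤ 4 * ε / a := by
  set S := Finset.univ.filter fun j => x j ≠ 0 with hS
  have hx0 : ∀ j ∈ Sᶜ, x j = 0 := fun j hj => by
    simpa [hS] using hj
  have hmin := hz.2 x hxq
  have hcone : ∑ j ∈ Sᶜ, |(z - x) j| ≤ ∑ j ∈ S, |(z - x) j| := by
    rw [← Finset.sum_add_sum_compl S (fun j => |z j|),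
      ← Finset.sum_add_sum_compl S (fun j => |x j|)] at hmin
    have h1 : ∑ j ∈ Sᶜ, |x j| = 0 := Finset.sum_eq_zero fun j hj => by rw [hx0 j hj, abs_zero]
    have h2 : ∑ j ∈ Sᶜ, |(z - x) j| = ∑ j ∈ Sᶜ, |z j| := Finset.sum_congr rfl fun j hj => by
      rw [Pi.sub_apply, hx0 j hj, sub_zero]
    have h3 : ∑ j ∈ S, |x j| ≤ ∑ j ∈ S, |z j| + ∑ j ∈ S, |(z - x) j| := by
      rw [← Finset.sum_add_distrib]
      refine Finset.sum_le_sum fun j _ => ?_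
      rw [Pi.sub_apply, abs_sub_comm]
      linarith [abs_sub_abs_le_abs_sub (x j) (z j)]
    rw [h2]
    linarith
  have hη : l2norm (Φ.mulVec (z - x)) ≤ 2 * ε := by
    have : Φ.mulVec (z - x) = (Φ.mulVec z - q) - (Φ.mulVec x - q) := by
      rw [Matrix.mulVec_sub]; abel
    rw [this]
    exact (l2norm_sub_le _ _).trans (by linarith [hz.1])
  have := abs_le_of_cone ha hB hs hks hlow hupp hx hcone hη j
  rw [Pi.sub_apply] at this
  refine this.trans (le_of_eq (by ring))

/-- If `z` is entrywise close to a sparse `x` with large nonzero entries, then the largest entries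
of `z` sit on a set containing the support of `x`. -/
lemma IsLargestIndexSet.mem_of_ne_zero {k : ℕ} {x z : Fin N → ℝ} {δ : ℝ} (hx : IsSparse k x)
    (hxδ : ∀ j, x j ≠ 0 → 2 * δ < |x j|) (hz : ∀ j, |z j - x j| ≤ δ) {T : Finset (Fin N)}
    (hT : IsLargestIndexSet k z T) (j : Fin N) (hj : x j ≠ 0) : j ∈ T := by
  by_contra hjT
  have hex : ∃ i ∈ T, x i = 0 := by
    by_contra! hcon
    have hsub : insert j T ⊆ Finset.univ.filter fun j => x j ≠ 0 := by
      intro i hi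
      rcases Finset.mem_insert.1 hi with rfl | hi
      · simpa using hj
      · simpa using hcon i hi
    have h1 := (Finset.card_le_card hsub).trans hx
    rw [Finset.card_insert_of_notMem hjT, hT.1] at h1
    omega
  obtain ⟨i, hi, hxi⟩ := hex
  have h1 := hT.2 i hi j hjT
  have h2 := hz i
  rw [hxi, sub_zero] at h2
  have h3 := abs_sub_abs_le_abs_sub (x j) (z j)
  rw [abs_sub_comm] at h3
  linarith [hz j, hxδ j hj]

end L1Recovery

/-! ### The reconstruction error -/

section Reconstruction

variable {m N : ℕ}

/-- Error analysis of the reconstruction, for a measurement matrix that is well conditioned on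
sparse vectors and whose `r`-fold integrated column submatrices have singular values at least
`σ`. -/
theorem reconstruction_of_bounds {Φ : Matrix (Fin m) (Fin N) ℝ} {r k s : ℕ} {a B σ Δ : ℝ}
    (hkN : k ≤ N) (ha : 0 < a) (hB : 0 ≤ B) (hσ : 0 < σ) (hΔ : 0 < Δ)
    (hs : 1 ≤ s) (hks : 4 * B ^ 2 * k ≤ a ^ 2 * s)
    (hlow : ∀ v, IsSparse (k + s) v → a * l2norm v ≤ l2norm (Φ.mulVec v))
    (hupp : ∀ v, IsSparse (k + s) v → l2norm (Φ.mulVec v) ≤ B * l2norm v)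
    (hdual : ∀ (x : Fin N → ℝ) (z : Fin m → ℝ), IsSparse k x →
      (diffMatrix m ^ r).mulVec z = Φ.mulVec x → σ * l2norm x ≤ l2norm z)
    {x : Fin N → ℝ} (hx : IsSparse k x)
    (hxΔ : ∀ j, x j ≠ 0 → 2 * (4 * (2 ^ r / 2 * Δ * √(m : ℝ)) / a) < |x j|) :
    (∃ q, IsQuantization r Δ (Φ.mulVec x) q) ∧
      ∀ q, IsQuantization r Δ (Φ.mulVec x) q →
        (∃ xhat, IsReconstruction r k Δ Φ q xhat) ∧
        ∀ xhat, IsReconstruction r k Δ Φ q xhat →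
          l2norm (x - xhat) ≤ σ⁻¹ * (√(m : ℝ) * (Δ / 2)) := by
  refine ⟨exists_isQuantization hΔ _, fun q hq => ?_⟩
  obtain ⟨e, he, heΔ⟩ := hq.exists_state hΔ
  have henorm : l2norm e ≤ √(m : ℝ) * (Δ / 2) := by
    refine l2norm_le_of_sq_le (by positivity) ?_
    rw [mul_pow, Real.sq_sqrt (Nat.cast_nonneg m)]
    refine (Finset.sum_le_card_nsmul _ _ ((Δ / 2) ^ 2) fun i _ => ?_).trans (by simp)
    rw [← sq_abs]
    exact pow_le_pow_left₀ (abs_nonneg _) (heΔ i) 2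
  have hfeas : l2norm (Φ.mulVec x - q) ≤ 2 ^ r / 2 * Δ * √(m : ℝ) := by
    rw [← he]
    have h1 : l2norm ((diffMatrix m ^ r).mulVec e) ^ 2 ≤ (2 ^ r * l2norm e) ^ 2 := by
      have h2 := energy_one_sub_X_pow_pow_mul_le m 1 r (toSeries e)
      rw [pow_one, ← energy_congr (X_pow_dvd_toSeries_diffMatrix_pow m r e), energy_toSeries,
        energy_toSeries] at h2
      rw [mul_pow, ← pow_mul, mul_comm r 2, pow_mul]
      norm_num
      exact h2
    have h3 := abs_le_of_sq_le_sq' h1 (mul_nonneg (by positivity) (l2norm_nonneg _)) |>.2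
    refine h3.trans ?_
    calc (2 : ℝ) ^ r * l2norm e ≤ 2 ^ r * (√(m : ℝ) * (Δ / 2)) := by gcongr
      _ = _ := by ring
  have hdual' : ∀ T : Finset (Fin N), T.card = k → ∀ (u : T → ℝ) (z : Fin m → ℝ),
      (diffMatrix m ^ r).mulVec z = (colSubmatrix Φ T).mulVec u → σ * l2norm u ≤ l2norm z := by
    intro T hT u z hz
    rw [colSubmatrix, submatrix_mulVec_extendZero] at hz
    rw [← l2norm_extendZero]
    refine hdual _ z ((Finset.card_le_card fun j hj => ?_).trans hT.le) hz
    by_contra h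
    simp [extendZero, h] at hj
  constructor
  · obtain ⟨z, hz⟩ := exists_isL1Minimizer Φ q _ hfeas
    obtain ⟨T, hT⟩ := exists_isLargestIndexSet hkN z
    obtain ⟨L, hL⟩ := (exists_isSobolevDual (colSubmatrix Φ T) hσ (hdual' T hT.1)).1
    exact ⟨extendZero (L.mulVec q), z, hz, T, hT, L, hL, fun j => by simp [extendZero],
      fun j hj => by simp [extendZero, hj]⟩
  · rintro xhat ⟨z, hz, T, hT, L, hL, hxT, hx0⟩
    have hsupp : ∀ j, x j ≠ 0 → j ∈ T :=
      hT.mem_of_ne_zero hx hxΔ (hz.abs_sub_le ha hB hs hks hlow hupp hx hfeas)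
    have hLq : L.mulVec q = (fun j : T => x j) - (L * diffMatrix m ^ r).mulVec e := by
      have h1 : q = Φ.mulVec x - (diffMatrix m ^ r).mulVec e := by rw [he]; abel
      have h2 : Φ.mulVec x = (colSubmatrix Φ T).mulVec (fun j : T => x j) := by
        rw [colSubmatrix, submatrix_mulVec_extendZero, extendZero_restrict hsupp]
      rw [h1, h2, Matrix.mulVec_sub, Matrix.mulVec_mulVec, Matrix.mulVec_mulVec, hL.1,
        Matrix.one_mulVec]
    have herr : x - xhat = extendZero ((L * diffMatrix m ^ r).mulVec e) := by
      ext j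
      by_cases hj : j ∈ T
      · have := hxT ⟨j, hj⟩
        rw [hLq] at this
        simp only [Pi.sub_apply] at this ⊢
        rw [this]
        simp [extendZero, hj]
      · have : x j = 0 := by by_contra h; exact hj (hsupp j h)
        simp [extendZero, hj, hx0 j hj, this]
    rw [herr, l2norm_extendZero]
    refine (l2norm_mulVec_le _ _).trans ?_
    exact mul_le_mul ((exists_isSobolevDual _ hσ (hdual' T hT.1)).2 L hL) henorm
      (l2norm_nonneg _) (by positivity)

end Reconstruction

/-! ### Choice of the parameters -/

lemma IsSubgaussian.hasSubgaussianMGF {Ω : Type*} [MeasurableSpace Ω] {μ : Measure Ω}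
    [IsProbabilityMeasure μ] {ρ : ℝ} (hρ : 0 < ρ) {Y : Ω → ℝ} (hY : Measurable Y)
    (h : IsSubgaussian μ ρ Y) (hmean : ∫ ω, Y ω ∂μ = 0) :
    HasSubgaussianMGF Y (52 * (ρ ^ 2).toNNReal) μ := by
  have hc : (0 : ℝ) < ρ ^ 2 := by positivity
  refine hasSubgaussianMGF_of_lintegral_exp_sq_le (Real.toNNReal_pos.2 hc) hY ?_ hmean
  rw [Real.coe_toNNReal _ hc.le]
  exact lintegral_exp_sq_le hc hY h

/-- The choice of the filter width: `h` is the integer part of `λ ^ α`, where `λ = m / k`, and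
`n + 1` windows of width `r h` fit into the `m` measurements. -/
lemma exists_window_parameters {r m N k : ℕ} (hr : 1 ≤ r) (hk : 1 ≤ k) (hkN : k ≤ N) {C α : ℝ}
    (hC : 1 ≤ C) (hCr : 4 * r ≤ C) (hα0 : 0 < α) (hα1 : α < 1)
    (hm : (C * Real.log (Real.exp 1 * N / k)) ^ (1 / (1 - α)) ≤ (m : ℝ) / k) :
    ∃ h n : ℕ, 1 ≤ h ∧ ((m : ℝ) / k) ^ α ≤ 2 * h ∧ r * h * (n + 1) ≤ m ∧
      (m : ℝ) ≤ 2 * r * h * n ∧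
      k * (C * Real.log (Real.exp 1 * N / k)) ≤ m * ((m : ℝ) / k) ^ (-α) ∧
      m * ((m : ℝ) / k) ^ (-α) ≤ 2 * r * n ∧ m * ((m : ℝ) / k) ^ (-α) ≤ m ∧ (1 : ℝ) ≤ m / k := by
  have hk0 : (0 : ℝ) < k := by exact_mod_cast hk
  have hr0 : (0 : ℝ) < r := by exact_mod_cast hr
  have hL := one_le_log_exp_mul_div hk hkN
  set L := Real.log (Real.exp 1 * N / k)
  set l : ℝ := (m : ℝ) / k with hl
  have hCL : 1 ≤ C * L := one_le_mul_of_one_le_of_one_le hC hL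
  have hα : 0 < 1 - α := by linarith
  have hl1 : 1 ≤ l := (Real.one_le_rpow hCL (by positivity)).trans hm
  have hl0 : 0 < l := by linarith
  have hCLl : C * L ≤ l ^ (1 - α) := by
    have := Real.rpow_le_rpow (by positivity) hm hα.le
    rwa [← Real.rpow_mul (by linarith), one_div_mul_cancel hα.ne', Real.rpow_one] at this
  have hmk : (m : ℝ) = k * l := by rw [hl]; field_simp
  have hml : m * l ^ (-α) = k * l ^ (1 - α) := by
    rw [hmk, sub_eq_add_neg, Real.rpow_add hl0, Real.rpow_one]; ring
  have hlα : 1 ≤ l ^ α := Real.one_le_rpow hl1 hα0.le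
  set h := ⌊l ^ α⌋₊
  have hh1 : 1 ≤ h := Nat.le_floor (by simpa using hlα)
  have hh1' : (1 : ℝ) ≤ h := by exact_mod_cast hh1
  have hhle : (h : ℝ) ≤ l ^ α := Nat.floor_le (by linarith)
  have hhlt : l ^ α < h + 1 := Nat.lt_floor_add_one _
  have hw0 : (0 : ℝ) < r * h := by positivity
  -- the number of windows, `m / (r h)`, is at least `4`
  have hy : m * l ^ (-α) ≤ m / h := by
    rw [Real.rpow_neg hl0.le, ← div_eq_mul_inv]
    gcongr
  have hkCL : k * (C * L) ≤ m * l ^ (-α) := by rw [hml]; gcongr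
  have hC4 : (4 : ℝ) * r ≤ m / h := by
    have h1 : C ≤ C * L := le_mul_of_one_le_right (by linarith) hL
    have h2 : C * L ≤ k * (C * L) :=
      le_mul_of_one_le_left (by linarith) (by exact_mod_cast hk)
    linarith
  have h4 : 4 * (r * h : ℝ) ≤ m := by
    rw [le_div_iff₀ (by linarith)] at hC4; linarith
  have h4' : 4 * (r * h) ≤ m := by exact_mod_cast h4
  have hw0' : 0 < r * h := Nat.mul_pos hr hh1
  have hdiv : 4 ≤ m / (r * h) := (Nat.le_div_iff_mul_le hw0').2 h4'
  -- one window is lost to the offsets and one to rounding, so half of at least `4` remain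
  have hmn : m ≤ 2 * r * h * (m / (r * h) - 1) := by
    have h1 : m < r * h * (m / (r * h) + 1) := Nat.lt_mul_div_succ m hw0'
    have h2 : m / (r * h) + 1 ≤ 2 * (m / (r * h) - 1) := by omega
    calc m ≤ r * h * (m / (r * h) + 1) := h1.le
      _ ≤ r * h * (2 * (m / (r * h) - 1)) := Nat.mul_le_mul_left _ h2
      _ = _ := by ring
  have hmn' : (m : ℝ) ≤ 2 * r * h * ((m / (r * h) - 1 : ℕ) : ℝ) := by exact_mod_cast hmn
  refine ⟨h, m / (r * h) - 1, hh1, by linarith, ?_, hmn', hkCL, hy.trans ?_, ?_, hl1⟩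
  · rw [Nat.sub_add_cancel (by omega)]
    exact Nat.mul_div_le m (r * h)
  · rw [div_le_iff₀ (by linarith)]
    linarith
  · refine mul_le_of_le_one_right (Nat.cast_nonneg m) ?_
    exact Real.rpow_le_one_of_one_le_of_nonpos hl1 (by linarith)

/-- The trivial filter, reading off the entries one by one. -/
lemma filteredEnergy_single {m : ℕ} (y : Fin m → ℝ) :
    filteredEnergy (fun (_ : Fin 1) (i p : Fin m) => if p = i then (1 : ℝ) else 0) y
      = l2norm y ^ 2 := by
  simp [filteredEnergy, l2norm_sq]

lemma mul_log_le_of_le {N k s : ℕ} {t : ℝ} (hk : 1 ≤ k) (hks : k ≤ s) (hsN : s ≤ N)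
    (hst : (s : ℝ) ≤ t * k) :
    s * Real.log (Real.exp 1 * N / s) ≤ t * (k * Real.log (Real.exp 1 * N / k)) := by
  have hk0 : (0 : ℝ) < k := by exact_mod_cast hk
  have hs : (k : ℝ) ≤ s := by exact_mod_cast hks
  have hN : (0 : ℝ) < N := by exact_mod_cast (hk.trans hks).trans hsN
  have hs0 : (0 : ℝ) < s := by linarith
  have hL := one_le_log_exp_mul_div hk (hks.trans hsN)
  have h1 : Real.log (Real.exp 1 * N / s) ≤ Real.log (Real.exp 1 * N / k) := by
    apply Real.log_le_log (by positivity)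
    gcongr
  calc _ ≤ (s : ℝ) * Real.log (Real.exp 1 * N / k) := by gcongr
    _ ≤ t * k * Real.log (Real.exp 1 * N / k) := by gcongr
    _ = _ := by ring

lemma isSparse_min {N s : ℕ} {x : Fin N → ℝ} (hx : IsSparse s x) : IsSparse (min s N) x :=
  le_min hx (by simpa using Finset.card_le_univ (Finset.univ.filter fun j => x j ≠ 0))

/-- Smallest singular values of the integrated measurement matrix: the energy gain `h ^ (2 r)` of
the filters, over `n` windows, with `h ≈ λ ^ α` and `n ≈ m λ ^ (-α)`. -/
lemma singular_value_bound {r m h n : ℕ} {l α X Z : ℝ} (hr : 1 ≤ r) (hl : 1 ≤ l)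
    (hh : l ^ α ≤ 2 * h) (hn : (m : ℝ) ≤ 2 * r * h * n) (hZ : 0 ≤ Z)
    (hE : (h : ℝ) ^ (2 * r) * (n / 16 * X ^ 2) ≤ 4 ^ r * Z ^ 2) :
    √(m : ℝ) * l ^ (α * ((r : ℝ) - 1 / 2)) / (4 * r * 4 ^ r) * X ≤ Z := by
  have hr0 : (1 : ℝ) ≤ r := by exact_mod_cast hr
  have hl0 : 0 < l := by linarith
  have hla : 0 < l ^ α := Real.rpow_pos_of_pos hl0 _
  refine abs_le_of_sq_le_sq' ?_ hZ |>.2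
  obtain ⟨s, rfl⟩ : ∃ s, r = s + 1 := ⟨r - 1, by omega⟩
  have hpow : (l ^ (α * (((s + 1 : ℕ) : ℝ) - 1 / 2))) ^ 2 = (l ^ α) ^ (2 * s + 1) := by
    rw [← Real.rpow_natCast, ← Real.rpow_natCast, ← Real.rpow_mul hl0.le, ← Real.rpow_mul hl0.le]
    congr 1
    push_cast
    ring
  rw [mul_pow, div_pow, mul_pow, Real.sq_sqrt (Nat.cast_nonneg m), hpow]
  have h1 : (m : ℝ) * (l ^ α) ^ (2 * s + 1)
      ≤ (2 * (s + 1 : ℕ) * h * n) * (2 * h) ^ (2 * s + 1) := by gcongr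
  have h2 : (2 * (s + 1 : ℕ) * h * n) * (2 * h : ℝ) ^ (2 * s + 1) * X ^ 2
      = 16 * (s + 1 : ℕ) * 4 ^ (s + 1) * ((h : ℝ) ^ (2 * (s + 1)) * (n / 16 * X ^ 2)) := by
    have : (4 : ℝ) ^ (s + 1) = 2 ^ (2 * s + 1) * 2 := by
      rw [← pow_succ, show (4 : ℝ) = 2 ^ 2 by norm_num, ← pow_mul]
      congr 1
    rw [this, mul_pow]
    ring
  have h3 : (m : ℝ) * (l ^ α) ^ (2 * s + 1) * X ^ 2
      ≤ 16 * (s + 1 : ℕ) * 4 ^ (s + 1) * (4 ^ (s + 1) * Z ^ 2) := by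
    refine (mul_le_mul_of_nonneg_right h1 (sq_nonneg X)).trans ?_
    rw [h2]
    gcongr
  rw [div_mul_eq_mul_div, div_le_iff₀ (by positivity)]
  refine h3.trans ?_
  have h4 : ((s + 1 : ℕ) : ℝ) ≤ ((s + 1 : ℕ) : ℝ) ^ 2 := by nlinarith
  calc 16 * ((s + 1 : ℕ) : ℝ) * 4 ^ (s + 1) * (4 ^ (s + 1) * Z ^ 2)
      ≤ 16 * ((s + 1 : ℕ) : ℝ) ^ 2 * 4 ^ (s + 1) * (4 ^ (s + 1) * Z ^ 2) := by gcongr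
    _ = _ := by ring

end SigmaDelta

open SigmaDelta MeasureTheory ProbabilityTheory in
theorem theorem2 (r : ℕ) (hr : 1 ≤ r) (ρ : ℝ) (hρ : 0 < ρ) :
    ∃ C C' K' c : ℝ, 0 < C ∧ 0 < C' ∧ 0 < K' ∧ 0 < c ∧
      ∀ (α : ℝ), 0 < α → α < 1 →
      ∀ (m N k : ℕ), 1 ≤ k → k ≤ N →
        (C * Real.log (Real.exp 1 * N / k)) ^ (1 / (1 - α)) ≤ (m : ℝ) / k →
      ∀ (Ω : Type*) [MeasurableSpace Ω] (μ : MeasureTheory.Measure Ω)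
        [MeasureTheory.IsProbabilityMeasure μ] (Φ : Ω → Matrix (Fin m) (Fin N) ℝ),
        (∀ i j, Measurable fun ω => Φ ω i j) →
        ProbabilityTheory.iIndepFun (fun (p : Fin m × Fin N) ω => Φ ω p.1 p.2) μ →
        (∀ i j, ∫ ω, Φ ω i j ∂μ = 0) →
        (∀ i j, ProbabilityTheory.variance (fun ω => Φ ω i j) μ = 1) →
        (∀ i j, SigmaDelta.IsSubgaussian μ ρ fun ω => Φ ω i j) →
      ∀ (Δ : ℝ), 0 < Δ →
      ∃ E : Set Ω, MeasurableSet E ∧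
        1 - Real.exp (-(c * (m * ((m : ℝ) / k) ^ (-α)))) ≤ μ.real E ∧
        ∀ ω ∈ E, ∀ x : Fin N → ℝ, SigmaDelta.IsSparse k x →
          (∀ j, x j ≠ 0 → K' * Δ < |x j|) →
          (∃ q, SigmaDelta.IsQuantization r Δ ((Φ ω).mulVec x) q) ∧
          ∀ q, SigmaDelta.IsQuantization r Δ ((Φ ω).mulVec x) q →
            (∃ xhat, SigmaDelta.IsReconstruction r k Δ (Φ ω) q xhat) ∧
            ∀ xhat, SigmaDelta.IsReconstruction r k Δ (Φ ω) q xhat →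
              SigmaDelta.l2norm (x - xhat) ≤
                C' * ((m : ℝ) / k) ^ (-(α * ((r : ℝ) - 1 / 2))) * Δ := by
  have hc : 0 < 52 * (ρ ^ 2).toNNReal := by
    have : 0 < (ρ ^ 2).toNNReal := Real.toNNReal_pos.2 (by positivity)
    positivity
  have hr0 : (1 : ℝ) ≤ r := by exact_mod_cast hr
  obtain ⟨C₀, γ, hC₀, hγ, hevent⟩ := exists_event_filteredEnergy_bounds _ hc
  set c : NNReal := 52 * (ρ ^ 2).toNNReal
  have hc' : (0 : ℝ) < c := hc
  -- the `ℓ¹` recovery uses blocks of `M k` entries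
  set M : ℕ := ⌈3072 * (c : ℝ)⌉₊
  have hM1 : 1 ≤ M := Nat.one_le_ceil_iff.2 (by positivity)
  have hMc : 3072 * (c : ℝ) ≤ M := Nat.le_ceil _
  -- the terms of the first constant serve, in turn, `λ ≥ 1`, the sample size for recovery from
  -- `Φ`, at least four windows, and the sample size after filtering
  refine ⟨1 + C₀ * (1 + M) + 4 * r + 2 * r * C₀, 2 * r * 4 ^ r, 16 * 2 ^ r, γ / (2 * r),
    by positivity, by positivity, by positivity, by positivity, ?_⟩
  intro α hα0 hα1 m N k hk hkN hm Ω _ μ _ Φ hmeas hind hmean hvar hsub Δ hΔ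
  have hk0 : (1 : ℝ) ≤ k := by exact_mod_cast hk
  obtain ⟨h, n, hh1, hh2, hfit, hmn, hkL, hmn2, hmm, hl1⟩ := exists_window_parameters hr hk hkN
    (C := 1 + C₀ * (1 + M) + 4 * r + 2 * r * C₀) (by
      have : 0 < C₀ * (1 + M) + 4 * r + 2 * r * C₀ := by positivity
      linarith)
    (by
      have : 0 < 1 + C₀ * (1 + M) + 2 * r * C₀ := by positivity
      linarith) hα0 hα1 hm
  have hL := one_le_log_exp_mul_div hk hkN
  set L := Real.log (Real.exp 1 * N / k)
  have hkL0 : 0 ≤ k * L := by positivity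
  have hmgf : ∀ i j, HasSubgaussianMGF (fun ω => Φ ω i j) c μ := fun i j =>
    (hsub i j).hasSubgaussianMGF hρ (hmeas i j) (hmean i j)
  have hm0 : (0 : ℝ) < m := by
    rcases Nat.eq_zero_or_pos m with h0 | h0
    · rw [h0] at hl1; norm_num at hl1
    · exact_mod_cast h0
  -- the measurement matrix itself
  have hMk : k ≤ k + M * k := Nat.le_add_right _ _
  obtain ⟨E₁, hE₁, hP₁, hb₁⟩ := hevent Ω μ Φ (n := m) (s := min (k + M * k) N) hmeas hind hmean hvar
    hmgf one_pos (le_min (hk.trans hMk) (hk.trans hkN)) (min_le_right _ _)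
    (fun (_ : Fin 1) (i p : Fin m) => if p = i then (1 : ℝ) else 0) (by simp)
    (by
      intro a i j hij p
      by_cases h1 : p = i
      · have : p ≠ j := fun h2 => hij (h1.symm.trans h2)
        simp [this]
      · simp [h1])
    (by
      have h1 := mul_log_le_of_le (t := 1 + M) hk (le_min hMk hkN) (min_le_right (k + M * k) N)
        (by
          have : ((min (k + M * k) N : ℕ) : ℝ) ≤ ((k + M * k : ℕ) : ℝ) := by
            exact_mod_cast min_le_left _ _
          refine this.trans (le_of_eq ?_)
          push_cast; ring)
      have h2 : C₀ * ((1 + M) * (k * L)) ≤ m := by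
        refine le_trans ?_ (hkL.trans hmm)
        have : 0 ≤ (1 + 4 * r + 2 * r * C₀) * (k * L) := by positivity
        linarith
      exact (mul_le_mul_of_nonneg_left h1 hC₀.le).trans h2)
  -- the filtered integrated matrix
  obtain ⟨V, hV1, hV2, hV3⟩ := exists_filters hr hh1 hfit
  obtain ⟨E₂, hE₂, hP₂, hb₂⟩ := hevent Ω μ Φ hmeas hind hmean hvar hmgf (Nat.mul_pos hr hh1) hk hkN
    V hV1 hV2
    (by
      have h2 : 2 * r * (C₀ * (k * L)) ≤ 2 * r * n := by
        refine le_trans ?_ (hkL.trans hmn2)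
        have : 0 ≤ (1 + C₀ * (1 + M) + 4 * r) * (k * L) := by positivity
        linarith
      exact le_of_mul_le_mul_left h2 (by positivity))
  refine ⟨E₁ ∩ E₂, hE₁.inter hE₂, ?_, fun ω hω x hx hxΔ => ?_⟩
  · have h1 : μ.real (E₁ ∩ E₂)ᶜ ≤ Real.exp (-(γ / (2 * r) * (m * ((m : ℝ) / k) ^ (-α)))) := by
      rw [Set.compl_inter]
      refine (measureReal_union_le _ _).trans ((add_le_add hP₁ hP₂).trans ?_)
      have e1 : Real.exp (-(γ * m)) ≤ Real.exp (-(γ / (2 * r) * (m * ((m : ℝ) / k) ^ (-α)))) := by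
        rw [Real.exp_le_exp, neg_le_neg_iff]
        have : γ / (2 * r) ≤ γ := div_le_self hγ.le (by linarith)
        gcongr
      have e2 : Real.exp (-(γ * n)) ≤ Real.exp (-(γ / (2 * r) * (m * ((m : ℝ) / k) ^ (-α)))) := by
        rw [Real.exp_le_exp, neg_le_neg_iff]
        calc _ ≤ γ / (2 * r) * (2 * r * n) := by gcongr
          _ = γ * n := by field_simp
      linarith
    rw [probReal_compl_eq_one_sub (hE₁.inter hE₂)] at h1
    linarith
  · have hsm : √(m : ℝ) ^ 2 = m := Real.sq_sqrt hm0.le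
    have hsm0 : 0 < √(m : ℝ) := Real.sqrt_pos.2 hm0
    have hsc : √(48 * (c : ℝ)) ^ 2 = 48 * c := Real.sq_sqrt (by positivity)
    have hl0 : (0 : ℝ) < m / k := by linarith
    have hlp : 0 < ((m : ℝ) / k) ^ (α * ((r : ℝ) - 1 / 2)) := Real.rpow_pos_of_pos hl0 _
    have key := reconstruction_of_bounds (Φ := Φ ω) (r := r) (k := k) (s := M * k)
      (a := √m / 4) (B := √(48 * c) * √m)
      (σ := √(m : ℝ) * ((m : ℝ) / k) ^ (α * ((r : ℝ) - 1 / 2)) / (4 * r * 4 ^ r)) (Δ := Δ)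
      hkN (by positivity) (by positivity) (by positivity) hΔ (Nat.mul_pos hM1 hk)
      (by
        rw [mul_pow, div_pow, hsm, hsc]
        push_cast
        have : 3072 * (c : ℝ) * (m * k) ≤ M * (m * k) := by gcongr
        linarith)
      (fun v hv => by
        have h1 := (hb₁ ω hω.1 v (isSparse_min hv)).1
        rw [filteredEnergy_single] at h1
        refine abs_le_of_sq_le_sq' ?_ (l2norm_nonneg _) |>.2
        rw [mul_pow, div_pow, hsm]
        linarith)
      (fun v hv => by
        have h1 := (hb₁ ω hω.1 v (isSparse_min hv)).2
        rw [filteredEnergy_single] at h1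
        refine abs_le_of_sq_le_sq' ?_ (mul_nonneg (by positivity) (l2norm_nonneg _)) |>.2
        rw [mul_pow, mul_pow, hsm, hsc]
        linarith)
      (fun u z hu hz => by
        have h1 := (hb₂ ω hω.2 u hu).1
        have h2 := hV3 z
        rw [hz] at h2
        exact singular_value_bound hr hl1 hh2 hmn (l2norm_nonneg _)
          ((mul_le_mul_of_nonneg_left h1 (by positivity)).trans h2))
      hx
      (fun j hj => by
        refine lt_of_le_of_lt (le_of_eq ?_) (hxΔ j hj)
        field_simp
        norm_num)
    refine ⟨key.1, fun q hq => ⟨(key.2 q hq).1, fun xhat hxhat => ?_⟩⟩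
    refine ((key.2 q hq).2 xhat hxhat).trans (le_of_eq ?_)
    rw [Real.rpow_neg hl0.le]
    field_simp
    ring
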